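/- **The game.** $n$ agents are the nodes of an undirected graph $G$ on a node set $V$, $\alpha>0$ is the edge price, and both endpoints of an edge pay for it. The cost of $u\in V$ is $\mathrm{cost}_G(u)=\alpha\deg_G(u)+\sum_{v\in V}\mathrm{dist}_G(u,v)$, where $\mathrm{dist}_G(u,v)$ is the hop distance, and $\mathrm{dist}_G(u,v)=M$ if $u,v$ are not connected; here $M\in\mathbb N$ is an arbitrary constant with $M>\alpha n^3$. An agent improves under a change if her cost strictly decreases. $G$ is in * *RE* if no agent improves by removing one incident edge; * *BAE* if there is no non-edge $uv$ such that $u$ and $v$ both improve when $uv$ is added; * *BSwE* (Bilateral Swap Equilibrium) if there are no $uv\in E$ and non-edge $uw$ such that $u$ and $w$ both improve when $uv$ is replaced by $uw$; * *BGE* (Bilateral Greedy Equilibrium) if it is in RE, BAE and BSwE; * *2-BSE* if there is no non-empty coalition $\Gamma\subseteq V$ of at most $2$ agents, set $R$ of edges each meeting $\Gamma$, and set $A$ of non-edges with both endpoints in $\Gamma$, such that all members of $\Gamma$ improve when $R$ is deleted and $A$ is added. The social cost of $G$ is $\sum_{u}\mathrm{cost}_G(u)$, and $\rho(G)$ is the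 social cost of $G$ divided by the minimum social cost of a graph on $n$ nodes. For an equilibrium notion, $\mathrm{PoA}(n,\alpha)$ on trees is the maximum of $\rho(G)$ over all trees $G$ with $n$ nodes in that equilibrium. **Stretched tree stars.** The $k$-stretched binary tree with parameter $d$ arises from the complete binary tree of depth $d$ by replacing every edge by a path with $k$ edges. The stretched tree star with stretch factor $k\in\mathbb N_{\ge1}$, target subtree size $t\in\mathbb R_{\ge 2k+1}$ and target size $\eta\in\mathbb N_{\ge 2t+1}$ consists of a root with $\lceil(\eta-1)/|T|\rceil$ copies of $T$ as child subtrees, where $T$ is the $k$-stretched binary tree with $d$ maximal subject to $|T|\le t$. **Theorem.** Logarithms are to base $2$. 1. For all sufficiently large $\alpha$ and every $\eta\in\mathbb N$ with $\eta\ge\alpha$ there is a stretched tree star $G$ with target size $\eta$ (a tree) with $\eta\le n\le\frac{3\eta}{2}$ nodes that is in BGE, is in 2-BSE, and satisfies $\rho(G)\ge\frac14\log\alpha-\frac{17}{8}$. 2. For every $\alpha\ge1$, every tree $G$ in BSwE satisfies $\rho(G)\le 2+2\log\alpha$. 3. For every $\alpha\ge1$, a tree is in BGE if and only if it is in 2-BSE.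 4. Consequently, the Price of Anarchy on trees is $\Theta(\log\alpha)$ for BSwE and for BGE, and $\Omega(\log\alpha)$ for 2-BSE, in the following sense. There are constants $c,C>0$ and $\alpha_0>1$ such that for every $\alpha\ge\alpha_0$: for all $n$, $\mathrm{PoA}(n,\alpha)\le C\log\alpha$ for BSwE and for BGE; and for every $\eta\in\mathbb N$ with $\eta\ge\alpha$ there is an $n$ with $\eta\le n\le\frac{3\eta}{2}$ such that $\mathrm{PoA}(n,\alpha)\ge c\log\alpha$ for BSwE, for BGE and for 2-BSE. -/

import Mathlib

namespace BNCG

/-! ### The bilateral network creation game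

A state of the game is identified with the created graph `G`: the strategy of agent `u` is the set
of neighbours of `u`, and an edge exists only if both endpoints agree to it. `α` is the edge price,
and `M` is the distance assigned to a pair of nodes in different components. -/

section Game

variable {V : Type*} [Fintype V]

open Classical in
/-- Hop distance, with the value `M` for nodes that are not connected by a path. -/
noncomputable def hopDist (M : ℕ) (G : SimpleGraph V) (u v : V) : ℕ :=
  if G.Reachable u v then G.dist u v else M

/-- Cost of agent `u`: edge price times number of bought edges, plus total distance. -/
noncomputable def agentCost (α : ℝ) (M : ℕ) (G : SimpleGraph V) (u : V) : ℝ :=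
  α * ((G.neighborSet u).ncard : ℝ) + ∑ v : V, (hopDist M G u v : ℝ)

/-- Agent `u` strictly prefers `H` to `G`. -/
def Improves (α : ℝ) (M : ℕ) (G H : SimpleGraph V) (u : V) : Prop :=
  agentCost α M H u < agentCost α M G u

/-- Social cost: the sum of the costs of all agents. -/
noncomputable def socialCost (α : ℝ) (M : ℕ) (G : SimpleGraph V) : ℝ :=
  ∑ u : V, agentCost α M G u

variable (V) in
/-- Cost of a social optimum: the minimum social cost of a graph on the node set `V`
(a minimum over finitely many graphs). -/
noncomputable def optCost (α : ℝ) (M : ℕ) : ℝ :=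
  ⨅ H : SimpleGraph V, socialCost α M H

/-- Social cost ratio of `G`. -/
noncomputable def costRatio (α : ℝ) (M : ℕ) (G : SimpleGraph V) : ℝ :=
  socialCost α M G / optCost V α M

/-- `G - uv`. -/
def removeEdge (G : SimpleGraph V) (u v : V) : SimpleGraph V :=
  G.deleteEdges {s(u, v)}

/-- `G + uv`. -/
def addEdge (G : SimpleGraph V) (u v : V) : SimpleGraph V :=
  G ⊔ SimpleGraph.edge u v

/-- Remove Equilibrium: no agent improves by removing a single incident edge. -/
def IsRE (α : ℝ) (M : ℕ) (G : SimpleGraph V) : Prop :=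
  ¬ ∃ u v : V, G.Adj u v ∧ Improves α M G (removeEdge G u v) u

/-- Bilateral Add Equilibrium: no two agents both improve by adding the edge between them. -/
def IsBAE (α : ℝ) (M : ℕ) (G : SimpleGraph V) : Prop :=
  ¬ ∃ u v : V, u ≠ v ∧ ¬ G.Adj u v ∧
    Improves α M G (addEdge G u v) u ∧ Improves α M G (addEdge G u v) v

/-- Pairwise Stability. -/
def IsPS (α : ℝ) (M : ℕ) (G : SimpleGraph V) : Prop :=
  IsRE α M G ∧ IsBAE α M G

/-- Bilateral Swap Equilibrium: no agent `u` can replace an incident edge `uv` by a new edge `uw`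
such that both `u` and `w` improve. -/
def IsBSwE (α : ℝ) (M : ℕ) (G : SimpleGraph V) : Prop :=
  ¬ ∃ u v w : V, G.Adj u v ∧ u ≠ w ∧ ¬ G.Adj u w ∧
    Improves α M G (addEdge (removeEdge G u v) u w) u ∧
    Improves α M G (addEdge (removeEdge G u v) u w) w

/-- Bilateral Greedy Equilibrium: pairwise stable and in Bilateral Swap Equilibrium. -/
def IsBGE (α : ℝ) (M : ℕ) (G : SimpleGraph V) : Prop :=
  IsPS α M G ∧ IsBSwE α M G

/-- Bilateral `k`-Strong Equilibrium: there is no (non-empty) coalition `Γ` of at most `k` agents,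
set `R` of edges that each meet `Γ`, and set `A` of non-edges inside `Γ` such that every
member of `Γ` improves when `R` is deleted and `A` is added. -/
def IsKBSE (k : ℕ) (α : ℝ) (M : ℕ) (G : SimpleGraph V) : Prop :=
  ¬ ∃ (Γ : Finset V) (R A : Set (Sym2 V)),
    Γ.Nonempty ∧ Γ.card ≤ k ∧
    R ⊆ G.edgeSet ∧ (∀ e ∈ R, ∃ x ∈ Γ, x ∈ e) ∧
    A ⊆ (G.edgeSet)ᶜ ∧ (∀ e ∈ A, ∀ x ∈ e, x ∈ Γ) ∧
    ∀ x ∈ Γ, Improves α M G (G.deleteEdges R ⊔ SimpleGraph.fromEdgeSet A) x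

end Game

/-- Price of Anarchy on trees with `n` nodes for an equilibrium notion `Eq`: the maximum
social cost ratio of a tree on `n` nodes in equilibrium. -/
noncomputable def treePoA
    (Eq : ∀ n : ℕ, ℝ → ℕ → SimpleGraph (Fin n) → Prop) (n : ℕ) (α : ℝ) (M : ℕ) : ℝ :=
  sSup {ρ : ℝ | ∃ G : SimpleGraph (Fin n), G.IsTree ∧ Eq n α M G ∧ ρ = costRatio α M G}

/-! ### Stretched binary trees and stretched tree stars -/

/-- Nodes of the complete binary tree of depth `d`: words over `{0,1}` of length at most `d`.
The root is the empty word. -/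
abbrev BinNode (d : ℕ) : Type := {l : List Bool // l.length ≤ d}

/-- `v` is a child of `u` in the complete binary tree. -/
def BinChild {d : ℕ} (u v : BinNode d) : Prop :=
  ∃ b : Bool, v.1 = b :: u.1

/-- Nodes of the `k`-stretched binary tree of depth parameter `d`: the root `none`, and for each
non-root node `u` of the complete binary tree the path nodes `u¹, …, uᵏ = u`;
`some (u, i)` stands for the path node of `u` with number `i + 1`. -/
abbrev StretchedNode (d k : ℕ) : Type :=
  Option ({u : BinNode d // u.1 ≠ []} × Fin k)

/-- Parent-child relation of the stretched binary tree. Each edge from a parent `u` to a child `v`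
of the complete binary tree becomes the path `u, v¹, v², …, vᵏ = v`. -/
def StretchedChild {d k : ℕ} : StretchedNode d k → StretchedNode d k → Prop
  | _, none => False
  | none, some (v, j) => BinChild ⟨[], Nat.zero_le d⟩ v.1 ∧ j.val = 0
  | some (u, i), some (v, j) =>
      (u = v ∧ j.val = i.val + 1) ∨ (BinChild u.1 v.1 ∧ i.val + 1 = k ∧ j.val = 0)

/-- The `k`-stretched binary tree of depth parameter `d`. -/
def stretchedTree (d k : ℕ) : SimpleGraph (StretchedNode d k) :=
  SimpleGraph.fromRel StretchedChild

/-- Adjacency from parents to children (and within copies) in the star of `m` stretched trees: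
the new root `none` is joined to the root of each of the `m` copies. -/
def StarRel {d k m : ℕ} :
    Option (Fin m × StretchedNode d k) → Option (Fin m × StretchedNode d k) → Prop
  | _, none => False
  | none, some (_, x) => x = none
  | some (i, x), some (j, y) => i = j ∧ (stretchedTree d k).Adj x y

/-- A root with `m` copies of the `k`-stretched binary tree of depth parameter `d` as child
subtrees. -/
def treeStar (d k m : ℕ) : SimpleGraph (Option (Fin m × StretchedNode d k)) :=
  SimpleGraph.fromRel StarRel

/-- `G` is (up to isomorphism) the stretched tree star with stretch factor `k ≥ 1`, target subtree
size `t ≥ 2k + 1` and target size `η ≥ 2t + 1`: with `T` the `k`-stretched binary tree whose depth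
parameter `d` is maximal subject to `|T| ≤ t`, it is a root with `⌈(η - 1) / |T|⌉` copies of `T`
as child subtrees. -/
def IsStretchedTreeStar {V : Type*} (k : ℕ) (t : ℝ) (η : ℕ) (G : SimpleGraph V) : Prop :=
  1 ≤ k ∧ 2 * (k : ℝ) + 1 ≤ t ∧ 2 * t + 1 ≤ (η : ℝ) ∧
    ∃ d : ℕ, IsGreatest {d' : ℕ | (Nat.card (StretchedNode d' k) : ℝ) ≤ t} d ∧
      Nonempty (G ≃g treeStar d k ⌈((η : ℝ) - 1) / (Nat.card (StretchedNode d k) : ℝ)⌉₊)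

end BNCG

namespace BNCG

open Finset SimpleGraph

/-! ### Disconnection is never an improvement -/

section Basics

variable {V : Type*} [Fintype V]

/-! Since `M` exceeds every agent's cost in a connected graph, improving moves out of a tree keep it
connected. Deleting a tree edge `px` leaves two sides, and a swap preserves connectedness only if
the new edge rejoins them. For a swap of `px` to `pw` the gains are then explicit: `p` gains iff `w`
has smaller total distance to the side of `x` than `x` has, and `w` gains iff its distance to `x`
times the size of the other side exceeds `α` (`improves_swap_left_iff`, `improves_swap_right_iff`).

BGE and 2-BSE agree because two agents can add only one edge, so edge counting allows at most one
removal; what remains is a removal, an addition or a swap (`isKBSE_two_of_isBGE`).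

Upper bound: root the tree at a 1-median `r`. Every subtree below `r` has at most `n/2` nodes, so a
node more than `2α/n` levels below `x` welcomes a swap from the parent of `x`. In BSwE the parent
must then not gain, which forces the lower subtree to be at most half of that of `x`. A subtree
rooted at depth 2 has at most `α` nodes. Hence the depth is at most `2 + (1 + 2α/n) log α`, and
comparison with the star, which is optimal, gives the ratio (`dist_le_mul_logb_card_side`,
`dist_median_le`, `optCost_eq`).

Lower bound: stretch factor 1 suffices. Take copies of a complete binary tree `T` of depth `d` about
`(log α)/2` with `|T|² ≤ α`. A parent does not gain by swapping a child, since sibling subtrees have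
equal size; any other swap or addition saves one of the agents whose consent is needed at most `|T|`
in distance to at most `|T|` nodes, hence at most `α`. Typical nodes in different copies are about
`2d` apart, while `n ≥ α` keeps the optimum of order `n²` (`isBGE_binStar`,
`le_socialCost_binStar`). -/

theorem hopDist_of_connected {M : ℕ} {G : SimpleGraph V} (hG : G.Connected) (u v : V) :
    hopDist M G u v = G.dist u v := by
  simp [hopDist, hG.preconnected u v]

theorem agentCost_of_connected {α : ℝ} {M : ℕ} {G : SimpleGraph V} (hG : G.Connected) (u : V) :
    agentCost α M G u = α * ((G.neighborSet u).ncard : ℝ) + ∑ v : V, (G.dist u v : ℝ) := by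
  simp [agentCost, hopDist_of_connected hG]

theorem le_agentCost_of_not_connected {α : ℝ} (hα : 0 ≤ α) {M : ℕ} {G : SimpleGraph V}
    (hG : ¬ G.Connected) (u : V) : (M : ℝ) ≤ agentCost α M G u := by
  have : ∃ v, ¬ G.Reachable u v := by
    by_contra! h
    have : Nonempty V := ⟨u⟩
    exact hG ⟨fun a b => (h a).symm.trans (h b)⟩
  obtain ⟨v, hv⟩ := this
  have h1 : (hopDist M G u v : ℝ) ≤ ∑ v : V, (hopDist M G u v : ℝ) :=
    Finset.single_le_sum (f := fun v => (hopDist M G u v : ℝ)) (fun _ _ => by positivity)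
      (Finset.mem_univ v)
  have h2 : hopDist M G u v = M := by simp [hopDist, hv]
  rw [h2] at h1
  have : 0 ≤ α * ((G.neighborSet u).ncard : ℝ) := by positivity
  unfold agentCost
  linarith

theorem dist_lt_card {G : SimpleGraph V} (hG : G.Connected) (u v : V) :
    G.dist u v < Fintype.card V := by
  obtain ⟨p, hp, hl⟩ := hG.exists_path_of_dist u v
  rw [← hl]
  exact hp.length_lt

theorem ncard_neighborSet_lt_card (G : SimpleGraph V) (u : V) :
    (G.neighborSet u).ncard < Fintype.card V := by
  classical
  rw [← Nat.card_eq_fintype_card, ← Set.ncard_univ]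
  refine Set.ncard_lt_ncard ?_ (Set.toFinite _)
  exact (Set.ssubset_univ_iff).2 fun h => G.irrefl (h ▸ Set.mem_univ u : u ∈ G.neighborSet u)

/-- Degree and distances are at most `n - 1`, and `(n - 1) + n(n - 1) ≤ n³`. -/
theorem agentCost_le_of_connected {α : ℝ} (hα : 1 ≤ α) {M : ℕ} {G : SimpleGraph V}
    (hG : G.Connected) (u : V) : agentCost α M G u ≤ α * (Fintype.card V : ℝ) ^ 3 := by
  rw [agentCost_of_connected hG]
  have hn : 1 ≤ (Fintype.card V : ℝ) := by
    exact_mod_cast Fintype.card_pos_iff.2 ⟨u⟩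
  set n : ℝ := (Fintype.card V : ℝ) with hndef
  have h1 : ((G.neighborSet u).ncard : ℝ) ≤ n - 1 := by
    have : ((G.neighborSet u).ncard : ℝ) + 1 ≤ n := by
      rw [hndef]
      exact_mod_cast Nat.succ_le_of_lt (ncard_neighborSet_lt_card G u)
    linarith
  have h2 : ∑ v : V, (G.dist u v : ℝ) ≤ ∑ _v : V, (n - 1) := by
    refine Finset.sum_le_sum fun v _ => ?_
    have : (G.dist u v : ℝ) + 1 ≤ n := by
      rw [hndef]
      exact_mod_cast Nat.succ_le_of_lt (dist_lt_card hG u v)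
    linarith
  rw [Finset.sum_const, Finset.card_univ, nsmul_eq_mul, ← hndef] at h2
  have h3 : α * ((G.neighborSet u).ncard : ℝ) ≤ α * (n - 1) :=
    mul_le_mul_of_nonneg_left h1 (by linarith)
  have h4 : n * (n - 1) ≤ α * (n * (n - 1)) := le_mul_of_one_le_left (by nlinarith) hα
  have h5 : α * ((n - 1) + n * (n - 1)) ≤ α * n ^ 3 := by
    refine mul_le_mul_of_nonneg_left ?_ (by linarith)
    nlinarith [mul_nonneg (sq_nonneg n) (sub_nonneg.2 hn)]
  nlinarith

theorem connected_of_improves {α : ℝ} (hα : 1 ≤ α) {M : ℕ} {G H : SimpleGraph V}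
    (hM : α * (Fintype.card V : ℝ) ^ 3 < (M : ℝ)) (hG : G.Connected) {u : V}
    (h : Improves α M G H u) : H.Connected := by
  by_contra hH
  have h1 := le_agentCost_of_not_connected (by linarith : (0 : ℝ) ≤ α) (M := M) hH u
  have h2 := agentCost_le_of_connected hα (M := M) hG u
  unfold Improves at h
  linarith

end Basics

/-! ### Geodesics, potentials and bridges -/

section Distances

variable {V : Type*}

theorem exists_adj_dist_add_one {G : SimpleGraph V} (hG : G.Connected) {a b : V} (hab : a ≠ b) :
    ∃ c, G.Adj a c ∧ G.dist c b + 1 = G.dist a b := by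
  obtain ⟨p, hp⟩ := hG.exists_walk_length_eq_dist a b
  cases p with
  | nil => exact absurd rfl hab
  | cons h q =>
    rename_i c
    refine ⟨c, h, ?_⟩
    have h1 := dist_le q
    have h2 := hG.dist_triangle (u := a) (v := c) (w := b)
    have h3 := dist_eq_one_iff_adj.2 h
    simp only [Walk.length_cons] at hp
    omega

theorem exists_dist_eq {G : SimpleGraph V} (hG : G.Connected) {a b : V} :
    ∀ {i : ℕ}, i ≤ G.dist a b → ∃ c, G.dist a c = i ∧ i + G.dist c b = G.dist a b := by
  intro i
  induction i with
  | zero => exact fun _ => ⟨a, by simp, by simp⟩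
  | succ i ih =>
    intro h
    obtain ⟨c, h1, h2⟩ := ih (by omega)
    have hcb : c ≠ b := by
      rintro rfl
      omega
    obtain ⟨e, h3, h4⟩ := exists_adj_dist_add_one hG hcb
    refine ⟨e, ?_, by omega⟩
    have h5 := hG.dist_triangle (u := a) (v := e) (w := b)
    have h6 := hG.dist_triangle (u := a) (v := c) (w := e)
    have h7 := dist_eq_one_iff_adj.2 h3
    omega

/-- A potential that grows by at most 1 along each edge certifies a lower bound on distance. This is
the tool for distances in modified graphs, where only walks, hence upper bounds, are explicit. -/
theorem le_add_dist_of_lipschitz {G : SimpleGraph V} {f : V → ℤ}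
    (hf : ∀ a b, G.Adj a b → f b ≤ f a + 1) {u v : V} (h : G.Reachable u v) :
    f v ≤ f u + G.dist u v := by
  obtain ⟨p, hp⟩ := h.exists_walk_length_eq_dist
  rw [← hp]
  clear hp h
  induction p with
  | nil => simp
  | cons h q ih =>
    have := hf _ _ h
    simp only [Walk.length_cons]
    push_cast
    linarith

theorem dist_le_dist_add_one {G : SimpleGraph V} (hG : G.Connected) {a b : V} (h : G.Adj a b)
    (c : V) : G.dist a c ≤ G.dist b c + 1 := by
  have h1 := hG.dist_triangle (u := a) (v := b) (w := c)
  have h2 := dist_eq_one_iff_adj.2 h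
  omega

theorem removeEdge_adj {G : SimpleGraph V} {u v a b : V} :
    (removeEdge G u v).Adj a b ↔ G.Adj a b ∧ ¬ (a = u ∧ b = v ∨ a = v ∧ b = u) := by
  simp [removeEdge]

theorem addEdge_adj {G : SimpleGraph V} {u v a b : V} :
    (addEdge G u v).Adj a b ↔ G.Adj a b ∨ ((a = u ∧ b = v ∨ a = v ∧ b = u) ∧ a ≠ b) := by
  simp [addEdge, edge_adj]

theorem removeEdge_comm (G : SimpleGraph V) (u v : V) : removeEdge G u v = removeEdge G v u := by
  simp [removeEdge, Sym2.eq_swap]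

theorem addEdge_comm (G : SimpleGraph V) (u v : V) : addEdge G u v = addEdge G v u := by
  simp [addEdge, edge_comm]

theorem removeEdge_le_addEdge (G : SimpleGraph V) (p x q w : V) :
    removeEdge G p x ≤ addEdge (removeEdge G p x) q w := le_sup_left

/-- Along a geodesic from `a` to `x` every node stays at least as close to `x` as to `p`, so the
geodesic avoids `p`. -/
theorem reachable_removeEdge {G : SimpleGraph V} (hG : G.Connected) {p x : V} (hpx : G.Adj p x)
    {a : V} (ha : G.dist a x ≤ G.dist a p) : (removeEdge G p x).Reachable a x := by
  induction hn : G.dist a x generalizing a with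
  | zero =>
    rw [hG.dist_eq_zero_iff.1 hn]
  | succ n ih =>
    have hax : a ≠ x := by
      rintro rfl
      simp at hn
    obtain ⟨c, h1, h2⟩ := exists_adj_dist_add_one hG hax
    have h3 := dist_le_dist_add_one hG h1 p
    have h4 : a ≠ p := by
      rintro rfl
      simp [dist_eq_one_iff_adj.2 hpx] at ha
    refine Reachable.trans (Adj.reachable ?_) (ih (a := c) (by omega) (by omega))
    rw [removeEdge_adj]
    exact ⟨h1, by tauto⟩

theorem not_reachable_removeEdge {G : SimpleGraph V} (hG : G.IsTree) {p x : V} (hpx : G.Adj p x) :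
    ¬ (removeEdge G p x).Reachable p x :=
  isBridge_iff.1 (isAcyclic_iff_forall_adj_isBridge.1 hG.isAcyclic hpx)

/-- An equidistant node would connect `p` and `x` without the edge `px`, but tree edges are bridges.
-/
theorem dist_ne_of_adj {G : SimpleGraph V} (hG : G.IsTree) {p x : V} (hpx : G.Adj p x) (v : V) :
    G.dist v x ≠ G.dist v p := by
  intro h
  have h1 := reachable_removeEdge hG.connected hpx h.le
  have h2 := reachable_removeEdge hG.connected hpx.symm h.ge
  rw [removeEdge_comm] at h2
  exact not_reachable_removeEdge hG hpx (h2.symm.trans h1)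

end Distances

/-! ### The two sides of a tree edge -/

section Sides

variable {V : Type*} [Fintype V]

/-- The nodes that are closer to `x` than to `p`; for an edge `px` of a tree these form the
component of `x` after deleting `px`. -/
noncomputable def side (G : SimpleGraph V) (p x : V) : Finset V :=
  univ.filter fun v => G.dist v x < G.dist v p

theorem mem_side {G : SimpleGraph V} {p x v : V} :
    v ∈ side G p x ↔ G.dist v x < G.dist v p := by
  simp [side]

theorem self_mem_side {G : SimpleGraph V} {p x : V} (h : G.Adj p x) : x ∈ side G p x := by
  simp [mem_side, dist_eq_one_iff_adj.2 h.symm]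

theorem notMem_side {G : SimpleGraph V} (p x : V) : p ∉ side G p x := by
  simp [mem_side]

theorem notMem_side_iff {G : SimpleGraph V} (hG : G.IsTree) {p x : V} (hpx : G.Adj p x) {v : V} :
    v ∉ side G p x ↔ v ∈ side G x p := by
  have := dist_ne_of_adj hG hpx v
  simp only [mem_side]
  omega

theorem side_compl {G : SimpleGraph V} [DecidableEq V] (hG : G.IsTree) {p x : V}
    (hpx : G.Adj p x) : (side G p x)ᶜ = side G x p := by
  ext v
  rw [mem_compl, notMem_side_iff hG hpx]

theorem dist_of_mem_side {G : SimpleGraph V} (hG : G.Connected) {p x : V} (hpx : G.Adj p x)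
    {v : V} (hv : v ∈ side G p x) : G.dist v p = G.dist v x + 1 := by
  have h1 := dist_le_dist_add_one hG hpx v
  rw [SimpleGraph.dist_comm, SimpleGraph.dist_comm (u := x)] at h1
  rw [mem_side] at hv
  omega

theorem eq_of_adj_of_mem_side {G : SimpleGraph V} (hG : G.IsTree) {p x : V} (hpx : G.Adj p x)
    {a b : V} (hab : G.Adj a b) (ha : a ∈ side G p x) (hb : b ∉ side G p x) : a = x ∧ b = p := by
  by_contra hne
  rw [notMem_side_iff hG hpx, mem_side] at hb
  rw [mem_side] at ha
  have h1 := reachable_removeEdge hG.connected hpx ha.le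
  have h2 := reachable_removeEdge hG.connected hpx.symm hb.le
  rw [removeEdge_comm] at h2
  have h3 : (removeEdge G p x).Adj a b := by
    rw [removeEdge_adj]
    refine ⟨hab, ?_⟩
    rintro (⟨rfl, rfl⟩ | h)
    · simp at ha
    · exact hne h
  exact not_reachable_removeEdge hG hpx ((h2.symm.trans h3.reachable.symm).trans h1)

/-- Sides are convex: a geodesic could leave only through `px`, and from `p` it would be farther
from its target than from `x`. -/
theorem exists_walk_removeEdge {G : SimpleGraph V} (hG : G.IsTree) {p x : V} (hpx : G.Adj p x)
    {a b : V} (ha : a ∈ side G p x) (hb : b ∈ side G p x) :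
    ∃ w : (removeEdge G p x).Walk a b, w.length = G.dist a b := by
  induction hn : G.dist a b generalizing a with
  | zero =>
    have := hG.connected.dist_eq_zero_iff.1 hn
    subst this
    exact ⟨Walk.nil, rfl⟩
  | succ n ih =>
    have hax : a ≠ b := by
      rintro rfl
      simp at hn
    obtain ⟨c, h1, h2⟩ := exists_adj_dist_add_one hG.connected hax
    by_cases hc : c ∈ side G p x
    · obtain ⟨w, hw⟩ := ih hc (by omega)
      have hac : (removeEdge G p x).Adj a c := by
        rw [removeEdge_adj]
        refine ⟨h1, ?_⟩
        rintro (⟨rfl, rfl⟩ | ⟨rfl, rfl⟩)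
        · exact notMem_side _ _ ha
        · exact notMem_side _ _ hc
      exact ⟨Walk.cons hac w, by rw [Walk.length_cons, hw]⟩
    · obtain ⟨rfl, rfl⟩ := eq_of_adj_of_mem_side hG hpx h1 ha hc
      have := mem_side.1 hb
      rw [SimpleGraph.dist_comm, SimpleGraph.dist_comm (u := b)] at this
      omega

theorem dist_of_mem_of_notMem {G : SimpleGraph V} (hG : G.IsTree) {p x : V} (hpx : G.Adj p x)
    {a b : V} (ha : a ∈ side G p x) (hb : b ∉ side G p x) :
    G.dist a b = G.dist a x + 1 + G.dist p b := by
  have hpb := dist_of_mem_side hG.connected hpx.symm ((notMem_side_iff hG hpx).1 hb)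
  rw [SimpleGraph.dist_comm, SimpleGraph.dist_comm (u := b)] at hpb
  have hle := hG.connected.dist_triangle (u := a) (v := x) (w := b)
  suffices h : G.dist a x + G.dist x b ≤ G.dist a b by omega
  clear hle
  induction hn : G.dist a b generalizing a with
  | zero =>
    have := hG.connected.dist_eq_zero_iff.1 hn
    subst this
    exact absurd ha hb
  | succ n ih =>
    have hax : a ≠ b := by
      rintro rfl
      simp at hn
    obtain ⟨c, h1, h2⟩ := exists_adj_dist_add_one hG.connected hax
    by_cases hc : c ∈ side G p x
    · have := ih hc (by omega)
      have := dist_le_dist_add_one hG.connected h1 x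
      omega
    · obtain ⟨rfl, rfl⟩ := eq_of_adj_of_mem_side hG hpx h1 ha hc
      simp only [SimpleGraph.dist_self]
      omega

theorem side_subset_side {G : SimpleGraph V} (hG : G.IsTree) {p x a b : V} (hpx : G.Adj p x)
    (hab : G.Adj a b) (ha : a ∈ side G p x) (hp : p ∉ side G a b) :
    side G a b ⊆ side G p x := by
  intro v hv
  by_contra hvx
  have h1 := dist_of_mem_of_notMem hG hab hv hp
  have h2 := dist_of_mem_of_notMem hG hpx ha hvx
  have h3 := dist_of_mem_side hG.connected hab hv
  have h4 := SimpleGraph.dist_comm (G := G) (u := v) (v := p)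
  have h5 := SimpleGraph.dist_comm (G := G) (u := v) (v := a)
  omega

end Sides

end BNCG

namespace BNCG

open Finset SimpleGraph

/-! ### Cost changes under an edge swap -/

section Swap

variable {V : Type*} [Fintype V]

theorem exists_walk_rejoin [DecidableEq V] {G : SimpleGraph V} (hG : G.IsTree) {p x q w : V}
    (hpx : G.Adj p x)
    (hq : q ∉ side G p x) (hw : w ∈ side G p x) (v : V) :
    ∃ c : (addEdge (removeEdge G p x) q w).Walk q v,
      c.length = if v ∈ side G p x then 1 + G.dist w v else G.dist q v := by
  have hqw : (addEdge (removeEdge G p x) q w).Adj q w := by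
    rw [addEdge_adj]
    refine Or.inr ⟨Or.inl ⟨rfl, rfl⟩, ?_⟩
    rintro rfl
    exact hq hw
  split_ifs with hv
  · obtain ⟨c, hc⟩ := exists_walk_removeEdge hG hpx hw hv
    exact ⟨Walk.cons hqw (c.mapLe (removeEdge_le_addEdge G p x q w)), by simp [hc, add_comm]⟩
  · rw [notMem_side_iff hG hpx] at hq hv
    obtain ⟨c, hc⟩ : ∃ c : (removeEdge G p x).Walk q v, c.length = G.dist q v := by
      rw [removeEdge_comm]
      exact exists_walk_removeEdge hG hpx.symm hq hv
    exact ⟨c.mapLe (removeEdge_le_addEdge G p x q w), by simp [hc]⟩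

theorem rejoin_connected {G : SimpleGraph V} (hG : G.IsTree) {p x q w : V} (hpx : G.Adj p x)
    (hq : q ∉ side G p x) (hw : w ∈ side G p x) :
    (addEdge (removeEdge G p x) q w).Connected := by
  classical
  have : Nonempty V := ⟨q⟩
  have h : ∀ v, (addEdge (removeEdge G p x) q w).Reachable q v := fun v =>
    (exists_walk_rejoin hG hpx hq hw v).choose.reachable
  exact ⟨fun a b => (h a).symm.trans (h b)⟩

/-- The explicit walk bounds the distance from above. The claimed value is itself a 1-Lipschitz
potential, because `px`, the only old edge between the sides, is gone; this bounds it from below. -/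
theorem rejoin_dist [DecidableEq V] {G : SimpleGraph V} (hG : G.IsTree) {p x q w : V}
    (hpx : G.Adj p x) (hq : q ∉ side G p x) (hw : w ∈ side G p x) (v : V) :
    (addEdge (removeEdge G p x) q w).dist q v =
      if v ∈ side G p x then 1 + G.dist w v else G.dist q v := by
  obtain ⟨c, hc⟩ := exists_walk_rejoin hG hpx hq hw v
  refine le_antisymm (hc ▸ SimpleGraph.dist_le c) ?_
  have key := le_add_dist_of_lipschitz (G := addEdge (removeEdge G p x) q w)
    (f := fun v => ((if v ∈ side G p x then 1 + G.dist w v else G.dist q v : ℕ) : ℤ))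
    (u := q) (v := v) ?_ c.reachable
  · simp only [hq, if_false, SimpleGraph.dist_self] at key
    simp only [Nat.cast_zero, zero_add] at key
    exact_mod_cast key
  · intro a b hab
    rw [addEdge_adj, removeEdge_adj] at hab
    rcases hab with ⟨hab, hne⟩ | ⟨⟨rfl, rfl⟩ | ⟨rfl, rfl⟩, -⟩
    · have h1 := dist_le_dist_add_one hG.connected hab.symm w
      have h2 := dist_le_dist_add_one hG.connected hab.symm q
      rw [SimpleGraph.dist_comm, SimpleGraph.dist_comm (u := a)] at h1 h2
      by_cases ha : a ∈ side G p x <;> by_cases hb : b ∈ side G p x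
      · simp only [ha, hb, if_true]
        push_cast
        omega
      · exact absurd (Or.inr (eq_of_adj_of_mem_side hG hpx hab ha hb)) hne
      · exact absurd (Or.inl (eq_of_adj_of_mem_side hG hpx hab.symm hb ha).symm) hne
      · simp only [ha, hb, if_false]
        omega
    · simp [hq, hw]
    · simp [hq, hw]

theorem rejoin_dist' [DecidableEq V] {G : SimpleGraph V} (hG : G.IsTree) {p x q w : V}
    (hpx : G.Adj p x) (hq : q ∉ side G p x) (hw : w ∈ side G p x) (v : V) :
    (addEdge (removeEdge G p x) q w).dist w v =
      if v ∈ side G p x then G.dist w v else 1 + G.dist q v := by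
  rw [notMem_side_iff hG hpx] at hq
  rw [← not_not (a := w ∈ _), notMem_side_iff hG hpx] at hw
  rw [removeEdge_comm, addEdge_comm, rejoin_dist hG hpx.symm hw hq]
  have := notMem_side_iff hG hpx (v := v)
  by_cases hv : v ∈ side G p x
  · rw [if_pos hv, if_neg]
    tauto
  · rw [if_neg hv, if_pos (this.1 hv)]

theorem not_connected_rejoin {G : SimpleGraph V} (hG : G.IsTree) {p x q w : V} (hpx : G.Adj p x)
    (hq : q ∉ side G p x) (hw : w ∉ side G p x) :
    ¬ (addEdge (removeEdge G p x) q w).Connected := by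
  classical
  intro h
  have key := le_add_dist_of_lipschitz (G := addEdge (removeEdge G p x) q w)
    -- No edge of the new graph leaves the side of `x`, so this potential is constant along edges;
    -- its jump exceeds every possible distance in a connected graph.
    (f := fun v => if v ∈ side G p x then (Fintype.card V : ℤ) + 1 else 0)
    (u := p) (v := x) ?_ (h.preconnected _ _)
  · simp only [notMem_side, self_mem_side hpx, if_true, if_false, zero_add] at key
    have := dist_lt_card h p x
    omega
  · intro a b hab
    rw [addEdge_adj, removeEdge_adj] at hab
    rcases hab with ⟨hab, hne⟩ | ⟨⟨rfl, rfl⟩ | ⟨rfl, rfl⟩, -⟩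
    · by_cases ha : a ∈ side G p x <;> by_cases hb : b ∈ side G p x
      · simp [ha, hb]
      · exact absurd (Or.inr (eq_of_adj_of_mem_side hG hpx hab ha hb)) hne
      · exact absurd (Or.inl (eq_of_adj_of_mem_side hG hpx hab.symm hb ha).symm) hne
      · simp [ha, hb]
    · simp [hq, hw]
    · simp [hq, hw]

theorem not_adj_of_mem_side {G : SimpleGraph V} (hG : G.IsTree) {p x w : V} (hpx : G.Adj p x)
    (hw : w ∈ side G p x) (hwx : w ≠ x) : ¬ G.Adj p w := fun h =>
  hwx (eq_of_adj_of_mem_side hG hpx h.symm hw (notMem_side p x)).1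

theorem ncard_neighborSet_swap_left {G : SimpleGraph V} {p x w : V} (hpx : G.Adj p x)
    (hpw : p ≠ w) (hw : ¬ G.Adj p w) :
    ((addEdge (removeEdge G p x) p w).neighborSet p).ncard = (G.neighborSet p).ncard := by
  have h1 : (addEdge (removeEdge G p x) p w).neighborSet p
      = insert w (G.neighborSet p \ {x}) := by
    ext v
    simp only [mem_neighborSet, addEdge_adj, removeEdge_adj, Set.mem_insert_iff, Set.mem_sdiff,
      Set.mem_singleton_iff, true_and]
    have := hpx.ne
    grind
  rw [h1, Set.ncard_insert_of_notMem (by simp [hw]) (Set.toFinite _),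
    Set.ncard_sdiff_singleton_add_one (by simpa using hpx) (Set.toFinite _)]

theorem ncard_neighborSet_swap_right {G : SimpleGraph V} {p x w : V}
    (hpw : p ≠ w) (hw : ¬ G.Adj p w) (hwx : w ≠ x) :
    ((addEdge (removeEdge G p x) p w).neighborSet w).ncard = (G.neighborSet w).ncard + 1 := by
  have h1 : (addEdge (removeEdge G p x) p w).neighborSet w = insert p (G.neighborSet w) := by
    ext v
    simp only [mem_neighborSet, addEdge_adj, removeEdge_adj, Set.mem_insert_iff]
    grind
  rw [h1, Set.ncard_insert_of_notMem (by simpa [G.adj_comm] using hw) (Set.toFinite _)]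

theorem sum_dist_eq_of_side {G : SimpleGraph V} [DecidableEq V] (p x a : V) :
    ∑ v, (G.dist a v : ℝ) =
      ∑ v ∈ side G p x, (G.dist a v : ℝ) + ∑ v ∈ (side G p x)ᶜ, (G.dist a v : ℝ) :=
  (Finset.sum_add_sum_compl _ _).symm

/-- The degree of `p` and its distances outside the side of `x` are unchanged; inside, `p` is one
step from the entry point, which moves from `x` to `w`. -/
theorem improves_swap_left_iff {α : ℝ} {M : ℕ} {G : SimpleGraph V} (hG : G.IsTree) {p x w : V}
    (hpx : G.Adj p x) (hw : w ∈ side G p x) (hwx : w ≠ x) :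
    Improves α M G (addEdge (removeEdge G p x) p w) p ↔
      ∑ v ∈ side G p x, (G.dist w v : ℝ) < ∑ v ∈ side G p x, (G.dist x v : ℝ) := by
  classical
  have hp := notMem_side (G := G) p x
  have hadj := not_adj_of_mem_side hG hpx hw hwx
  have hpw : p ≠ w := by
    rintro rfl
    exact hp hw
  rw [Improves, agentCost_of_connected (rejoin_connected hG hpx hp hw),
    agentCost_of_connected hG.connected, ncard_neighborSet_swap_left hpx hpw hadj,
    sum_dist_eq_of_side (G := G) p x, ← Finset.sum_add_sum_compl (side G p x)]
  have h1 : ∑ v ∈ side G p x, ((addEdge (removeEdge G p x) p w).dist p v : ℝ)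
      = ∑ v ∈ side G p x, (1 + (G.dist w v : ℝ)) := by
    refine Finset.sum_congr rfl fun v hv => ?_
    rw [rejoin_dist hG hpx hp hw, if_pos hv]
    push_cast
    rfl
  have h2 : ∑ v ∈ (side G p x)ᶜ, ((addEdge (removeEdge G p x) p w).dist p v : ℝ)
      = ∑ v ∈ (side G p x)ᶜ, (G.dist p v : ℝ) := by
    refine Finset.sum_congr rfl fun v hv => ?_
    rw [rejoin_dist hG hpx hp hw, if_neg (by simpa using hv)]
  have h3 : ∑ v ∈ side G p x, (G.dist p v : ℝ) = ∑ v ∈ side G p x, (1 + (G.dist x v : ℝ)) := by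
    refine Finset.sum_congr rfl fun v hv => ?_
    rw [SimpleGraph.dist_comm, dist_of_mem_side hG.connected hpx hv, SimpleGraph.dist_comm]
    push_cast
    ring
  rw [h1, h2, h3, Finset.sum_add_distrib, Finset.sum_add_distrib]
  constructor <;> intro h <;> linarith

/-- The agent `w` pays for one more edge and skips the path from `w` to `x` on the way to every node
beyond `p`. -/
theorem improves_swap_right_iff {α : ℝ} {M : ℕ} {G : SimpleGraph V} [DecidableEq V]
    (hG : G.IsTree) {p x w : V} (hpx : G.Adj p x) (hw : w ∈ side G p x) (hwx : w ≠ x) :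
    Improves α M G (addEdge (removeEdge G p x) p w) w ↔
      α < (G.dist w x : ℝ) * ((side G p x)ᶜ.card : ℝ) := by
  have hp := notMem_side (G := G) p x
  have hadj := not_adj_of_mem_side hG hpx hw hwx
  have hpw : p ≠ w := by
    rintro rfl
    exact hp hw
  rw [Improves, agentCost_of_connected (rejoin_connected hG hpx hp hw),
    agentCost_of_connected hG.connected, ncard_neighborSet_swap_right hpw hadj hwx,
    sum_dist_eq_of_side (G := G) p x, ← Finset.sum_add_sum_compl (side G p x)]
  have h1 : ∑ v ∈ side G p x, ((addEdge (removeEdge G p x) p w).dist w v : ℝ)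
      = ∑ v ∈ side G p x, (G.dist w v : ℝ) := by
    refine Finset.sum_congr rfl fun v hv => ?_
    rw [rejoin_dist' hG hpx hp hw, if_pos hv]
  have h2 : ∑ v ∈ (side G p x)ᶜ, ((addEdge (removeEdge G p x) p w).dist w v : ℝ)
      = ∑ v ∈ (side G p x)ᶜ, (1 + (G.dist p v : ℝ)) := by
    refine Finset.sum_congr rfl fun v hv => ?_
    rw [rejoin_dist' hG hpx hp hw, if_neg (by simpa using hv)]
    push_cast
    rfl
  have h3 : ∑ v ∈ (side G p x)ᶜ, (G.dist w v : ℝ)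
      = ∑ v ∈ (side G p x)ᶜ, ((G.dist w x : ℝ) + (1 + (G.dist p v : ℝ))) := by
    refine Finset.sum_congr rfl fun v hv => ?_
    rw [dist_of_mem_of_notMem hG hpx hw (by simpa using hv)]
    push_cast
    ring
  rw [h1, h2, h3, Finset.sum_add_distrib (f := fun _ => (G.dist w x : ℝ)), Finset.sum_const,
    nsmul_eq_mul]
  push_cast
  constructor <;> intro h <;> linarith

end Swap

/-! ### BGE and 2-BSE coincide on trees -/

section TwoAgentCoalitions

variable {V : Type*} [Fintype V]

theorem isBGE_of_isKBSE_two {α : ℝ} {M : ℕ} {G : SimpleGraph V} (h : IsKBSE 2 α M G) :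
    IsBGE α M G := by
  classical
  refine ⟨⟨?_, ?_⟩, ?_⟩
  · rintro ⟨u, v, huv, hi⟩
    refine h ⟨{u}, {s(u, v)}, ∅, by simp, by simp, by simpa using huv, by simp, by simp, by simp,
      ?_⟩
    simpa [removeEdge] using hi
  · rintro ⟨u, v, hne, huv, hi, hj⟩
    refine h ⟨{u, v}, ∅, {s(u, v)}, by simp, Finset.card_le_two, by simp, by simp,
      by simpa using huv, by simp, ?_⟩
    have : G.deleteEdges ∅ ⊔ fromEdgeSet {s(u, v)} = addEdge G u v := by
      simp [addEdge, edge]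
    simpa [this] using ⟨hi, hj⟩
  · rintro ⟨u, v, w, huv, hne, huw, hi, hj⟩
    refine h ⟨{u, w}, {s(u, v)}, {s(u, w)}, by simp, Finset.card_le_two, by simpa using huv,
      by simp, by simpa using huw, by simp, ?_⟩
    have : G.deleteEdges {s(u, v)} ⊔ fromEdgeSet {s(u, w)} = addEdge (removeEdge G u v) u w := by
      simp [addEdge, edge, removeEdge]
    simpa [this] using ⟨hi, hj⟩

theorem isKBSE_two_of_isBGE {α : ℝ} (hα : 1 ≤ α) {M : ℕ} {G : SimpleGraph V}
    (hM : α * (Fintype.card V : ℝ) ^ 3 < (M : ℝ)) (hG : G.IsTree) (h : IsBGE α M G) :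
    IsKBSE 2 α M G := by
  classical
  rintro ⟨Γ, R, A, ⟨g, hg⟩, hcard, hRG, hRΓ, hAG, hAΓ, himp⟩
  set H := G.deleteEdges R ⊔ fromEdgeSet A with hH
  have hconn : H.Connected := connected_of_improves hα hM hG.connected (himp g hg)
  have hcardE := hconn.card_vert_le_card_edgeSet_add_one
  have hGE := (isTree_iff_connected_and_card.1 hG).2
  have hHE : H.edgeSet = (G.edgeSet \ R) ∪ (A \ Sym2.diagSet) := by
    simp [hH, edgeSet_sup]
  rw [Nat.card_coe_set_eq] at hcardE hGE
  -- The complement of the edge set contains the diagonal pairs, which `fromEdgeSet` ignores; only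
  -- off-diagonal pairs are real additions.
  by_cases hA : A \ Sym2.diagSet = ∅
  · have hR : R = ∅ := by
      by_contra hR
      have h1 : (G.edgeSet \ R).ncard < G.edgeSet.ncard := by
        refine Set.ncard_lt_ncard ?_ (Set.toFinite _)
        obtain ⟨e, he⟩ := Set.nonempty_iff_ne_empty.2 hR
        exact ⟨Set.sdiff_subset, fun h => (h (hRG he)).2 he⟩
      rw [hHE, hA, Set.union_empty] at hcardE
      omega
    have : H = G := by
      rw [← edgeSet_inj, hHE, hA, hR]
      simp
    have := himp g hg
    simp_all [Improves]
  · obtain ⟨e, heA, hed⟩ := Set.nonempty_iff_ne_empty.2 hA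
    induction e with
    | h a b =>
    have hab : a ≠ b := by simpa using hed
    have haΓ := hAΓ _ heA a (by simp)
    have hbΓ := hAΓ _ heA b (by simp)
    have hΓ : Γ = {a, b} := by
      symm
      refine Finset.eq_of_subset_of_card_le ?_ (by rw [Finset.card_pair hab]; exact hcard)
      intro y hy
      rcases Finset.mem_insert.1 hy with rfl | hy
      · exact haΓ
      · rwa [Finset.mem_singleton.1 hy]
    have hAe : A \ Sym2.diagSet = {s(a, b)} := by
      refine Set.Subset.antisymm ?_ (by simpa using ⟨heA, hab⟩)
      rintro f ⟨hf, hfd⟩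
      induction f with
      | h c d =>
      have hc := hAΓ _ hf c (by simp)
      have hd := hAΓ _ hf d (by simp)
      have hcd : c ≠ d := by simpa using hfd
      simp only [hΓ, Finset.mem_insert, Finset.mem_singleton] at hc hd
      simp only [Set.mem_singleton_iff, Sym2.eq_iff]
      rcases hc with rfl | rfl <;> rcases hd with rfl | rfl <;> simp_all
    have hnadj : ¬ G.Adj a b := by simpa using hAG heA
    have hHeq : ∀ c d : V, (H.Adj c d ↔
        (G.Adj c d ∧ s(c, d) ∉ R) ∨ ((c = a ∧ d = b ∨ c = b ∧ d = a) ∧ c ≠ d)) := by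
      intro c d
      rw [← mem_edgeSet, hHE, hAe]
      simp only [Set.mem_union, Set.mem_sdiff, mem_edgeSet, Set.mem_singleton_iff, Sym2.eq_iff]
      grind
    -- A connected graph has at least `|V| - 1` edges, and only one was added.
    have hRcard : R.ncard ≤ 1 := by
      have h1 : H.edgeSet.ncard ≤ (G.edgeSet \ R).ncard + 1 := by
        rw [hHE, hAe]
        exact (Set.ncard_union_le _ _).trans (by simp)
      have h2 := Set.ncard_sdiff_add_ncard_of_subset hRG (Set.toFinite _)
      omega
    have hai := himp a haΓ
    have hbi := himp b hbΓ
    rcases (Set.ncard_le_one_iff_eq (Set.toFinite _)).1 hRcard with hR | ⟨e, hR⟩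
    · have : H = addEdge G a b := by
        ext c d
        rw [hHeq, hR, addEdge_adj]
        simp
      rw [this] at hai hbi
      exact h.1.2 ⟨a, b, hab, hnadj, hai, hbi⟩
    · have heR : e ∈ R := by simp [hR]
      obtain ⟨x, hxΓ, hxe⟩ := hRΓ e heR
      obtain ⟨y, rfl⟩ := Sym2.mem_iff_exists.1 hxe
      have hxy : G.Adj x y := by simpa using hRG heR
      have hHx : H = addEdge (removeEdge G x y) a b := by
        ext c d
        rw [hHeq, hR, addEdge_adj, removeEdge_adj]
        simp
      -- The removed edge meets the coalition, hence shares an endpoint with the added edge: the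
      -- move is a swap by that endpoint.
      rw [hΓ, Finset.mem_insert, Finset.mem_singleton] at hxΓ
      rcases hxΓ with rfl | rfl
      · rw [hHx] at hai hbi
        exact h.2 ⟨x, y, b, hxy, hab, hnadj, hai, hbi⟩
      · rw [hHx, addEdge_comm] at hai hbi
        exact h.2 ⟨x, y, a, hxy, hab.symm, fun h => hnadj h.symm, hbi, hai⟩

end TwoAgentCoalitions

end BNCG

namespace BNCG

open Finset SimpleGraph

/-! ### The star is a social optimum -/

section Optimum

variable {V : Type*} [Fintype V]

theorem sum_ncard_neighborSet (G : SimpleGraph V) :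
    ∑ u, (G.neighborSet u).ncard = 2 * Nat.card G.edgeSet := by
  classical
  rw [Nat.card_eq_fintype_card, ← edgeFinset_card, ← sum_degrees_eq_twice_card_edges]
  refine Finset.sum_congr rfl fun u _ => ?_
  rw [← Nat.card_coe_set_eq, Nat.card_eq_fintype_card, card_neighborSet_eq_degree]

theorem socialCost_of_connected {α : ℝ} {M : ℕ} {G : SimpleGraph V} (hG : G.Connected) :
    socialCost α M G = 2 * α * (Nat.card G.edgeSet : ℝ) + ∑ u, ∑ v, (G.dist u v : ℝ) := by
  have h := congrArg (Nat.cast (R := ℝ)) (sum_ncard_neighborSet G)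
  push_cast at h
  simp only [socialCost, agentCost_of_connected hG]
  rw [Finset.sum_add_distrib, ← Finset.mul_sum, h]
  ring

theorem sum_sum_dist_le {G : SimpleGraph V} (hG : G.Connected) (r : V) :
    ∑ u, ∑ v, (G.dist u v : ℝ) ≤ 2 * ((Fintype.card V : ℝ) - 1) * ∑ v, (G.dist r v : ℝ) := by
  classical
  have h1 : ∀ u, ∑ v, (G.dist u v : ℝ) ≤ (Fintype.card V : ℝ) * G.dist r u
      + ∑ v, (G.dist r v : ℝ) - 2 * G.dist r u := by
    intro u
    -- Routing through `r` overcounts the pair `(u, u)` by `2 dist(r, u)`; recording this improves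
    -- the final factor from `n` to `n - 1`.
    have h2 : ∑ v, ((G.dist u v : ℝ) + if v = u then 2 * (G.dist r u : ℝ) else 0)
        ≤ ∑ v, ((G.dist r u : ℝ) + G.dist r v) := by
      refine Finset.sum_le_sum fun v _ => ?_
      split_ifs with h
      · subst h
        simp
        linarith
      · have := hG.dist_triangle (u := u) (v := r) (w := v)
        rw [SimpleGraph.dist_comm (u := u) (v := r)] at this
        rw [add_zero]
        exact_mod_cast this
    rw [Finset.sum_add_distrib, Finset.sum_add_distrib, Finset.sum_ite_eq' univ u,
      if_pos (mem_univ u), Finset.sum_const, nsmul_eq_mul, card_univ] at h2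
    linarith
  refine (Finset.sum_le_sum fun u _ => h1 u).trans (le_of_eq ?_)
  rw [Finset.sum_sub_distrib, Finset.sum_add_distrib, ← Finset.mul_sum, ← Finset.mul_sum,
    Finset.sum_const, nsmul_eq_mul, card_univ]
  ring

theorem socialCost_tree_le {α : ℝ} {M : ℕ} {G : SimpleGraph V} (hG : G.IsTree) (r : V) :
    socialCost α M G ≤
      2 * ((Fintype.card V : ℝ) - 1) * (α + ∑ v, (G.dist r v : ℝ)) := by
  have h1 := (isTree_iff_connected_and_card.1 hG).2
  have h2 : (Nat.card G.edgeSet : ℝ) = (Fintype.card V : ℝ) - 1 := by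
    rw [← Nat.card_eq_fintype_card, ← h1]
    push_cast
    ring
  rw [socialCost_of_connected hG.connected, h2]
  have := sum_sum_dist_le hG.connected r
  linarith

theorem two_mul_le_sum_dist_add_ncard {G : SimpleGraph V} (hG : G.Connected) (u : V) :
    2 * ((Fintype.card V : ℝ) - 1) ≤ ∑ v, (G.dist u v : ℝ) + ((G.neighborSet u).ncard : ℝ) := by
  classical
  have h1 : ((G.neighborSet u).ncard : ℝ) = ∑ v, if G.Adj u v then (1 : ℝ) else 0 := by
    rw [Finset.sum_boole, Set.ncard_eq_toFinset_card']
    congr 2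
    ext v
    simp
  have h2 : ∑ v, ((2 : ℝ) - if v = u then 2 else 0)
      ≤ ∑ v, ((G.dist u v : ℝ) + if G.Adj u v then (1 : ℝ) else 0) := by
    refine Finset.sum_le_sum fun v _ => ?_
    by_cases hvu : v = u
    · subst hvu
      simp
    · by_cases ha : G.Adj u v
      · simp [hvu, ha, dist_eq_one_iff_adj.2 ha]
        norm_num
      · have := hG.one_lt_dist_of_ne_of_not_adj (Ne.symm hvu) ha
        simp only [hvu, ha, if_false, sub_zero, add_zero]
        exact_mod_cast this
  rw [Finset.sum_sub_distrib, Finset.sum_ite_eq' univ u, if_pos (mem_univ u), Finset.sum_const,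
    nsmul_eq_mul, card_univ, Finset.sum_add_distrib] at h2
  rw [h1]
  linarith

/-- In a connected graph non-neighbours are at distance at least 2, so each agent pays at least `(α
- 1) deg + 2(n - 1)`; now use `α ≥ 1` and at least `n - 1` edges. In a disconnected graph every
agent pays at least `M`. -/
theorem le_socialCost [Nonempty V] {α : ℝ} (hα : 1 ≤ α) {M : ℕ}
    (hM : α * (Fintype.card V : ℝ) ^ 3 < (M : ℝ)) (G : SimpleGraph V) :
    2 * ((Fintype.card V : ℝ) - 1) * (α + (Fintype.card V : ℝ) - 1) ≤ socialCost α M G := by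
  have hn : 1 ≤ (Fintype.card V : ℝ) := by exact_mod_cast Fintype.card_pos
  by_cases hG : G.Connected
  · have h1 : ∑ u : V, ((α - 1) * ((G.neighborSet u).ncard : ℝ) + 2 * ((Fintype.card V : ℝ) - 1))
        ≤ socialCost α M G := by
      refine Finset.sum_le_sum fun u _ => ?_
      rw [agentCost_of_connected hG]
      linarith [two_mul_le_sum_dist_add_ncard hG u]
    have h2 := congrArg (Nat.cast (R := ℝ)) (sum_ncard_neighborSet G)
    push_cast at h2
    rw [Finset.sum_add_distrib, ← Finset.mul_sum, h2, Finset.sum_const, nsmul_eq_mul,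
      card_univ] at h1
    have h3 : (Fintype.card V : ℝ) - 1 ≤ (Nat.card G.edgeSet : ℝ) := by
      have := hG.card_vert_le_card_edgeSet_add_one
      rw [Nat.card_eq_fintype_card (α := V)] at this
      have : (Fintype.card V : ℝ) ≤ (Nat.card G.edgeSet : ℝ) + 1 := by exact_mod_cast this
      linarith
    have h4 := mul_le_mul_of_nonneg_left h3 (by linarith : (0 : ℝ) ≤ 2 * (α - 1))
    nlinarith
  · have h1 : ∑ _u : V, (M : ℝ) ≤ socialCost α M G :=
      Finset.sum_le_sum fun u _ => le_agentCost_of_not_connected (by linarith) hG u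
    rw [Finset.sum_const, nsmul_eq_mul, card_univ] at h1
    by_cases h2 : Fintype.card V = 1
    · rw [h2] at h1 ⊢
      push_cast at h1 ⊢
      have : (0 : ℝ) ≤ M := by positivity
      linarith
    · have h3 : (2 : ℝ) ≤ (Fintype.card V : ℝ) := by
        have := Fintype.card_pos (α := V)
        exact_mod_cast (by omega : 2 ≤ Fintype.card V)
      set n : ℝ := (Fintype.card V : ℝ)
      have h4 : α + n - 1 ≤ α * n := by nlinarith
      have h5 : 2 * (n - 1) * (α + n - 1) ≤ 2 * (n - 1) * (α * n) :=
        mul_le_mul_of_nonneg_left h4 (by linarith)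
      have h6 : n * (α * n ^ 3) ≤ n * M := by gcongr
      have h7 : 2 * (n - 1) * (α * n) ≤ n * (α * n ^ 3) := by
        have : 2 * (n - 1) ≤ n ^ 3 := by nlinarith [sq_nonneg n]
        have h8 : 0 ≤ α * n := by positivity
        nlinarith [mul_le_mul_of_nonneg_right this h8]
      linarith

theorem optCost_eq [Nonempty V] {α : ℝ} (hα : 1 ≤ α) {M : ℕ}
    (hM : α * (Fintype.card V : ℝ) ^ 3 < (M : ℝ)) :
    optCost V α M = 2 * ((Fintype.card V : ℝ) - 1) * (α + (Fintype.card V : ℝ) - 1) := by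
  classical
  refine le_antisymm ?_ (le_ciInf fun G => le_socialCost hα hM G)
  obtain ⟨c⟩ := ‹Nonempty V›
  have hn : 1 ≤ (Fintype.card V : ℝ) := by exact_mod_cast Fintype.card_pos_iff.2 ⟨c⟩
  have hbdd : BddBelow (Set.range fun H : SimpleGraph V => socialCost α M H) :=
    (Set.finite_range _).bddBelow
  refine (ciInf_le hbdd (starGraph c)).trans ?_
  refine (socialCost_tree_le (isTree_starGraph c) c).trans ?_
  refine mul_le_mul_of_nonneg_left ?_ (by linarith)
  have h1 : ∑ v, ((starGraph c).dist c v : ℝ) ≤ ∑ v, ((1 : ℝ) - if v = c then 1 else 0) := by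
    refine Finset.sum_le_sum fun v _ => ?_
    split_ifs with h
    · simp [h]
    · simp [dist_eq_one_iff_adj.2 (starGraph_center_adj (Ne.symm h))]
  rw [Finset.sum_sub_distrib, Finset.sum_ite_eq' univ c, if_pos (mem_univ c), Finset.sum_const,
    nsmul_eq_mul, card_univ] at h1
  linarith

end Optimum

/-! ### The logarithmic upper bound for BSwE -/

section UpperBound

variable {V : Type*} [Fintype V]

/-- Moving from `x` to `b` brings each node of the side closer by exactly `dist(x, b)` and takes any
other node at most that much farther. If the move does not pay on `S`, the side is at most half of
`S`. -/
theorem two_mul_card_side_le {G : SimpleGraph V} (hG : G.IsTree) {a b x : V} (hab : G.Adj a b)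
    (hx : x ∉ side G a b) {S : Finset V} (hS : side G a b ⊆ S)
    (hsum : ∑ v ∈ S, (G.dist x v : ℝ) ≤ ∑ v ∈ S, (G.dist b v : ℝ)) :
    2 * (side G a b).card ≤ S.card := by
  classical
  have hb := self_mem_side hab
  have hL : 0 < (G.dist x b : ℝ) := by
    exact_mod_cast hG.connected.pos_dist_of_ne fun h => hx (by rwa [h])
  have h1 : ∑ v ∈ side G a b, ((G.dist b v : ℝ) + G.dist x b)
      = ∑ v ∈ side G a b, (G.dist x v : ℝ) := by
    refine Finset.sum_congr rfl fun v hv => ?_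
    have e1 := dist_of_mem_of_notMem hG hab hv hx
    have e2 := dist_of_mem_of_notMem hG hab hb hx
    rw [SimpleGraph.dist_self] at e2
    rw [SimpleGraph.dist_comm (u := v) (v := x), SimpleGraph.dist_comm (u := v) (v := b)] at e1
    rw [SimpleGraph.dist_comm (u := b) (v := x)] at e2
    have : G.dist b v + G.dist x b = G.dist x v := by omega
    exact_mod_cast this
  have h2 : ∑ v ∈ S \ side G a b, (G.dist b v : ℝ)
      ≤ ∑ v ∈ S \ side G a b, ((G.dist x v : ℝ) + G.dist x b) := by
    refine Finset.sum_le_sum fun v _ => ?_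
    have := hG.connected.dist_triangle (u := b) (v := x) (w := v)
    rw [SimpleGraph.dist_comm (u := b) (v := x)] at this
    have : G.dist b v ≤ G.dist x v + G.dist x b := by omega
    exact_mod_cast this
  rw [← Finset.sum_sdiff hS, ← Finset.sum_sdiff hS, ← h1] at hsum
  rw [Finset.sum_add_distrib, Finset.sum_const, nsmul_eq_mul] at h2 hsum
  have h3 : ((side G a b).card : ℝ) * G.dist x b ≤ ((S \ side G a b).card : ℝ) * G.dist x b := by
    linarith
  have h4 : (side G a b).card ≤ (S \ side G a b).card := by
    exact_mod_cast le_of_mul_le_mul_right h3 hL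
  have h5 := Finset.card_sdiff_add_card_eq_card hS
  omega

theorem sum_dist_le_of_isBSwE {α : ℝ} {M : ℕ} {G : SimpleGraph V} [DecidableEq V] (hG : G.IsTree)
    (hE : IsBSwE α M G) {p x w : V} (hpx : G.Adj p x) (hw : w ∈ side G p x) (hwx : w ≠ x)
    (h : α < (G.dist w x : ℝ) * ((side G p x)ᶜ.card : ℝ)) :
    ∑ v ∈ side G p x, (G.dist x v : ℝ) ≤ ∑ v ∈ side G p x, (G.dist w v : ℝ) := by
  by_contra! hlt
  refine hE ⟨p, x, w, hpx, ?_, not_adj_of_mem_side hG hpx hw hwx,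
    (improves_swap_left_iff hG hpx hw hwx).2 hlt, (improves_swap_right_iff hG hpx hw hwx).2 h⟩
  rintro rfl
  exact notMem_side _ _ hw

/-- Induction on a bound for the subtree size: descending `j ≤ 1 + 2α/n` levels at least halves the
subtree, so the depth is at most `j` per halving. -/
theorem dist_le_mul_logb_card_side {α : ℝ} (hα : 0 < α) {M : ℕ} {G : SimpleGraph V}
    (hG : G.IsTree) (hE : IsBSwE α M G) {r : V}
    (hr : ∀ x, ∑ v, (G.dist r v : ℝ) ≤ ∑ v, (G.dist x v : ℝ)) (N : ℕ) :
    ∀ {p x y : V}, G.Adj p x → r ∉ side G p x → (side G p x).card ≤ N → y ∈ side G p x →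
      (G.dist x y : ℝ) ≤ (1 + 2 * α / Fintype.card V) * Real.logb 2 (side G p x).card := by
  classical
  have hn : 0 < (Fintype.card V : ℝ) := by exact_mod_cast Fintype.card_pos_iff.2 ⟨r⟩
  have hc : 0 ≤ 2 * α / Fintype.card V := by positivity
  induction N with
  | zero =>
    intro p x y hpx _ hcard _
    have := Finset.card_pos.2 ⟨x, self_mem_side hpx⟩
    omega
  | succ N ih =>
    intro p x y hpx hrx hcard hy
    have hx := self_mem_side hpx
    have hpos : 1 ≤ (side G p x).card := Finset.card_pos.2 ⟨x, hx⟩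
    -- The least natural number above `2α/n`: since the median leaves at least `n/2` nodes outside
    -- the side, a node `j` levels down wants the swap.
    set j := ⌊2 * α / Fintype.card V⌋₊ + 1 with hj
    have hj1 : 2 * α / Fintype.card V < j := by
      rw [hj]
      push_cast
      exact Nat.lt_floor_add_one _
    have hj2 : (j : ℝ) ≤ 1 + 2 * α / Fintype.card V := by
      rw [hj]
      push_cast
      linarith [Nat.floor_le hc]
    rcases lt_or_ge (G.dist x y) j with hlt | hge
    · have hle : (G.dist x y : ℝ) ≤ 2 * α / Fintype.card V :=
        (Nat.cast_le.2 (Nat.lt_succ_iff.1 hlt)).trans (Nat.floor_le hc)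
      by_cases hxy : x = y
      · subst hxy
        rw [SimpleGraph.dist_self, Nat.cast_zero]
        exact mul_nonneg (by linarith)
          (Real.logb_nonneg one_lt_two (by exact_mod_cast hpos))
      · have h2 : 2 ≤ (side G p x).card := Finset.one_lt_card.2 ⟨x, hx, y, hy, hxy⟩
        have h3 : 1 ≤ Real.logb 2 (side G p x).card := by
          rw [Real.le_logb_iff_rpow_le one_lt_two (by positivity)]
          simpa using (by exact_mod_cast h2 : (2 : ℝ) ≤ (side G p x).card)
        nlinarith
    · obtain ⟨w, hw1, hw2⟩ := exists_dist_eq hG.connected hge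
      have hwx : w ≠ x := by
        rintro rfl
        simp at hw1
      -- Here `w'` is the predecessor of `w` on the way from `x`, so the side of `w` across `w'w` is
      -- the subtree to be halved.
      obtain ⟨w', hww, hw3⟩ := exists_adj_dist_add_one hG.connected hwx
      have t1 := dist_of_mem_side hG.connected hpx hy
      have t2 := hG.connected.dist_triangle (u := y) (v := w) (w := p)
      have t3 := dist_le_dist_add_one hG.connected hww p
      have t4 := hG.connected.dist_triangle (u := x) (v := w') (w := y)
      have c1 := SimpleGraph.dist_comm (G := G) (u := y) (v := x)
      have c2 := SimpleGraph.dist_comm (G := G) (u := y) (v := w)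
      have c3 := SimpleGraph.dist_comm (G := G) (u := w) (v := x)
      have c4 := SimpleGraph.dist_comm (G := G) (u := w') (v := x)
      have c5 := SimpleGraph.dist_comm (G := G) (u := y) (v := w')
      have hwS : w ∈ side G p x := by
        rw [mem_side]
        omega
      have hwS' : w' ∈ side G p x := by
        rw [mem_side]
        omega
      have t5 := dist_of_mem_side hG.connected hpx hwS
      have t6 := dist_of_mem_side hG.connected hpx hwS'
      have hp : p ∉ side G w' w := by
        rw [mem_side, SimpleGraph.dist_comm, SimpleGraph.dist_comm (u := p)]
        omega
      have hxw : x ∉ side G w' w := by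
        rw [mem_side]
        omega
      have hyw : y ∈ side G w' w := by
        rw [mem_side]
        omega
      have hsub := side_subset_side hG hpx hww.symm hwS' hp
      have hhalf := two_mul_card_side_le hG hpx hrx (Finset.subset_univ _) (hr x)
      have hcompl : (side G p x)ᶜ.card + (side G p x).card = Fintype.card V :=
        Finset.card_compl_add_card _
      rw [card_univ] at hhalf
      have hbig : α < (G.dist w x : ℝ) * ((side G p x)ᶜ.card : ℝ) := by
        have e1 : (Fintype.card V : ℝ) ≤ 2 * ((side G p x)ᶜ.card : ℝ) := by
          exact_mod_cast (by omega : Fintype.card V ≤ 2 * (side G p x)ᶜ.card)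
        have e2 : (G.dist w x : ℝ) = j := by
          rw [c3, hw1]
        rw [div_lt_iff₀ hn] at hj1
        rw [e2]
        have := mul_le_mul_of_nonneg_left e1 (by positivity : (0 : ℝ) ≤ j)
        linarith
      have hs := two_mul_card_side_le hG hww.symm hxw hsub
        (sum_dist_le_of_isBSwE hG hE hpx hwS hwx hbig)
      have hpos' : 1 ≤ (side G w' w).card := Finset.card_pos.2 ⟨y, hyw⟩
      have key := ih hww.symm (fun h => hrx (hsub h)) (by omega) hyw
      have hlog : 1 + Real.logb 2 (side G w' w).card ≤ Real.logb 2 (side G p x).card := by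
        have e1 : (0 : ℝ) < (side G w' w).card := by exact_mod_cast hpos'
        have e2 : 1 + Real.logb 2 (side G w' w).card
            = Real.logb 2 (2 * (side G w' w).card) := by
          rw [Real.logb_mul two_ne_zero e1.ne', Real.logb_self_eq_one one_lt_two]
        rw [e2]
        exact Real.logb_le_logb_of_le one_lt_two (by positivity) (by exact_mod_cast hs)
      have e3 : (G.dist x y : ℝ) = j + G.dist w y := by exact_mod_cast hw2.symm
      rw [e3]
      have := mul_le_mul_of_nonneg_left hlog (by linarith : 0 ≤ 1 + 2 * α / Fintype.card V)
      linarith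

theorem dist_median_le {α : ℝ} (hα : 1 ≤ α) {M : ℕ} {G : SimpleGraph V}
    (hG : G.IsTree) (hE : IsBSwE α M G) {r : V}
    (hr : ∀ x, ∑ v, (G.dist r v : ℝ) ≤ ∑ v, (G.dist x v : ℝ)) (y : V) :
    (G.dist r y : ℝ) ≤ 2 + (1 + 2 * α / Fintype.card V) * Real.logb 2 α := by
  classical
  have hc : 0 ≤ 2 * α / Fintype.card V := by positivity
  have hlog : 0 ≤ Real.logb 2 α := Real.logb_nonneg one_lt_two hα
  rcases lt_or_ge (G.dist r y) 2 with hlt | hge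
  · have : (G.dist r y : ℝ) ≤ 2 := by exact_mod_cast hlt.le
    have := mul_nonneg (by linarith : 0 ≤ 1 + 2 * α / Fintype.card V) hlog
    linarith
  -- Depth 2 is needed so that `x` can swap its parent `p` for the grandparent `r`.
  · obtain ⟨x, hx1, hx2⟩ := exists_dist_eq hG.connected hge
    have hxr : x ≠ r := by
      rintro rfl
      simp at hx1
    obtain ⟨p, hxp, hp⟩ := exists_adj_dist_add_one hG.connected hxr
    have hpx := hxp.symm
    have c1 := SimpleGraph.dist_comm (G := G) (u := x) (v := r)
    have c2 := SimpleGraph.dist_comm (G := G) (u := p) (v := r)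
    have c3 := SimpleGraph.dist_comm (G := G) (u := x) (v := y)
    have c4 := SimpleGraph.dist_comm (G := G) (u := p) (v := y)
    have t1 := hG.connected.dist_triangle (u := r) (v := p) (w := y)
    have hrS : r ∉ side G p x := by
      rw [mem_side]
      omega
    have hyS : y ∈ side G p x := by
      rw [mem_side]
      omega
    have hrp : r ≠ p := by
      rintro rfl
      simp at hp
      omega
    -- Otherwise `r` accepts the edge `xr` in place of `xp`, as it gets one step closer to more than
    -- `α` nodes. By BSwE, `p` is then no worse than `r` outside the subtree of `x`; being strictly
    -- better inside it, `p` would beat the median.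
    have hcard : ((side G p x).card : ℝ) ≤ α := by
      by_contra! hlt
      have h1 := sum_dist_le_of_isBSwE hG hE hxp ((notMem_side_iff hG hpx).1 hrS) hrp (by
        rw [side_compl hG hxp, show G.dist r p = 1 by omega]
        simpa using hlt)
      have h2 := hr p
      rw [sum_dist_eq_of_side (G := G) p x, sum_dist_eq_of_side (G := G) p x,
        side_compl hG hpx] at h2
      have h3 : ∑ v ∈ side G p x, (G.dist p v : ℝ) < ∑ v ∈ side G p x, (G.dist r v : ℝ) := by
        refine Finset.sum_lt_sum_of_nonempty ⟨y, hyS⟩ fun v hv => ?_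
        have e1 := dist_of_mem_side hG.connected hpx hv
        have e2 := dist_of_mem_of_notMem hG hpx hv hrS
        have e3 := SimpleGraph.dist_comm (G := G) (u := v) (v := p)
        have e4 := SimpleGraph.dist_comm (G := G) (u := v) (v := r)
        exact_mod_cast (by omega : G.dist p v < G.dist r v)
      linarith
    have hpos : 0 < ((side G p x).card : ℝ) := by exact_mod_cast Finset.card_pos.2 ⟨y, hyS⟩
    have h1 := dist_le_mul_logb_card_side (by linarith) hG hE hr _ hpx hrS le_rfl hyS
    have h2 := Real.logb_le_logb_of_le one_lt_two hpos hcard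
    have h3 := mul_le_mul_of_nonneg_left h2 (by linarith : 0 ≤ 1 + 2 * α / Fintype.card V)
    have h4 : (G.dist r y : ℝ) = 2 + G.dist x y := by exact_mod_cast hx2.symm
    linarith

theorem costRatio_le_of_isBSwE {α : ℝ} (hα : 1 ≤ α) {M : ℕ} {G : SimpleGraph V}
    (hM : α * (Fintype.card V : ℝ) ^ 3 < (M : ℝ)) (hG : G.IsTree) (hE : IsBSwE α M G) :
    costRatio α M G ≤ 2 + 2 * Real.logb 2 α := by
  classical
  have hne : Nonempty V := hG.connected.nonempty
  have hlog : 0 ≤ Real.logb 2 α := Real.logb_nonneg one_lt_two hα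
  obtain ⟨r, -, hr⟩ := Finset.exists_min_image univ (fun x => ∑ v, (G.dist x v : ℝ))
    Finset.univ_nonempty
  have hn : 1 ≤ (Fintype.card V : ℝ) := by exact_mod_cast Fintype.card_pos
  have hdist := dist_median_le hα hG hE (fun x => hr x (mem_univ x))
  have hsum : ∑ v, (G.dist r v : ℝ) ≤ ((Fintype.card V : ℝ) - 1)
      * (2 + (1 + 2 * α / Fintype.card V) * Real.logb 2 α) := by
    rw [← Finset.sum_erase_add _ _ (mem_univ r), SimpleGraph.dist_self, Nat.cast_zero, add_zero]
    refine (Finset.sum_le_card_nsmul _ _ _ fun v _ => hdist v).trans (le_of_eq ?_)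
    rw [nsmul_eq_mul, Finset.card_erase_of_mem (mem_univ r), card_univ,
      Nat.cast_sub Fintype.card_pos, Nat.cast_one]
  have hcost := socialCost_tree_le (α := α) (M := M) hG r
  rw [costRatio, optCost_eq hα hM]
  set n : ℝ := (Fintype.card V : ℝ)
  refine div_le_of_le_mul₀ (mul_nonneg (by linarith) (by linarith)) (by linarith) ?_
  refine hcost.trans ?_
  rw [mul_left_comm]
  refine mul_le_mul_of_nonneg_left ?_ (by linarith)
  have h1 : (n - 1) * (1 + 2 * α / n) ≤ n - 1 + 2 * α := by
    have : (n - 1) * (2 * α / n) ≤ 2 * α := by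
      rw [mul_div_assoc', div_le_iff₀ (by linarith)]
      nlinarith
    linarith
  have h2 := mul_le_mul_of_nonneg_right h1 hlog
  nlinarith

end UpperBound

end BNCG

namespace BNCG

open Finset SimpleGraph

/-! ### Further facts about trees -/

section TreeLemmas

variable {V : Type*}

theorem mem_iff_of_reachable {G : SimpleGraph V} {D : Set V}
    (hD : ∀ a b, G.Adj a b → a ∈ D → b ∈ D) {a b : V} (h : G.Reachable a b) :
    a ∈ D ↔ b ∈ D := by
  obtain ⟨p⟩ := h
  induction p with
  | nil => rfl
  | cons h q ih => exact ⟨fun ha => ih.1 (hD _ _ h ha), fun hb => hD _ _ h.symm (ih.2 hb)⟩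

theorem min_le_dist_addEdge {G : SimpleGraph V} (hG : G.Connected) {u v : V} (x : V) :
    min (G.dist u x) (1 + G.dist v x) ≤ (addEdge G u v).dist u x := by
  have hc : (addEdge G u v).Connected := hG.mono le_sup_left
  have key := le_add_dist_of_lipschitz (G := addEdge G u v)
    (f := fun x => ((min (G.dist u x) (1 + G.dist v x) : ℕ) : ℤ)) (u := u) (v := x) ?_
    (hc.preconnected _ _)
  · simp only [SimpleGraph.dist_self, Nat.zero_min, Nat.cast_zero, zero_add] at key
    exact_mod_cast key
  · intro a b hab
    rw [addEdge_adj] at hab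
    rcases hab with hab | ⟨⟨rfl, rfl⟩ | ⟨rfl, rfl⟩, -⟩
    · have h1 := dist_le_dist_add_one hG hab.symm u
      have h2 := dist_le_dist_add_one hG hab.symm v
      rw [SimpleGraph.dist_comm, SimpleGraph.dist_comm (u := a)] at h1 h2
      omega
    · simp only [SimpleGraph.dist_self]
      omega
    · simp only [SimpleGraph.dist_self]
      omega

variable [Fintype V]

/-- Going from `a` to `w` costs exactly `dist(w, a)` for each node of `S` outside the side and saves
at most that for each node inside. -/
theorem sum_dist_le_of_card_side_le {G : SimpleGraph V} [DecidableEq V] (hG : G.IsTree)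
    {a b w : V} (hab : G.Adj a b) (hw : w ∈ side G a b) {S : Finset V} (hS : side G a b ⊆ S)
    (hcard : (side G a b).card ≤ (S \ side G a b).card) :
    ∑ v ∈ S, (G.dist a v : ℝ) ≤ ∑ v ∈ S, (G.dist w v : ℝ) := by
  have h1 : ∑ v ∈ side G a b, (G.dist a v : ℝ)
      ≤ ∑ v ∈ side G a b, ((G.dist w v : ℝ) + G.dist w a) := by
    refine Finset.sum_le_sum fun v _ => ?_
    have := hG.connected.dist_triangle (u := a) (v := w) (w := v)
    rw [SimpleGraph.dist_comm (u := a) (v := w)] at this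
    have : G.dist a v ≤ G.dist w v + G.dist w a := by omega
    exact_mod_cast this
  have h2 : ∑ v ∈ S \ side G a b, (G.dist w v : ℝ)
      = ∑ v ∈ S \ side G a b, ((G.dist a v : ℝ) + G.dist w a) := by
    refine Finset.sum_congr rfl fun v hv => ?_
    have e1 := dist_of_mem_of_notMem hG hab hw (Finset.mem_sdiff.1 hv).2
    have e2 := dist_of_mem_side hG.connected hab hw
    have : G.dist w v = G.dist a v + G.dist w a := by omega
    exact_mod_cast this
  have h3 : ((side G a b).card : ℝ) * G.dist w a ≤ ((S \ side G a b).card : ℝ) * G.dist w a := by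
    gcongr
  rw [← Finset.sum_sdiff hS, ← Finset.sum_sdiff hS, h2]
  rw [Finset.sum_add_distrib, Finset.sum_const, nsmul_eq_mul] at h1 ⊢
  linarith

theorem coe_side_eq {G : SimpleGraph V} (hG : G.IsTree) {p x : V} (hpx : G.Adj p x) {D : Set V}
    (hx : x ∈ D) (hp : p ∉ D) (hD : ∀ a b, G.Adj a b → a ∈ D → b ∉ D → a = x ∧ b = p) :
    (side G p x : Set V) = D := by
  have hinv : ∀ a b, (removeEdge G p x).Adj a b → a ∈ D → b ∈ D := by
    intro a b hab ha
    by_contra hb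
    rw [removeEdge_adj] at hab
    exact hab.2 (Or.inr (hD a b hab.1 ha hb))
  ext v
  rw [Finset.mem_coe]
  constructor
  · intro hv
    exact (mem_iff_of_reachable hinv
      (reachable_removeEdge hG.connected hpx (mem_side.1 hv).le)).2 hx
  · intro hv
    by_contra hv'
    rw [notMem_side_iff hG hpx, mem_side] at hv'
    have := reachable_removeEdge hG.connected hpx.symm hv'.le
    rw [removeEdge_comm] at this
    exact hp ((mem_iff_of_reachable hinv this).1 hv)

theorem isRE_of_isTree {α : ℝ} (hα : 1 ≤ α) {M : ℕ} {G : SimpleGraph V}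
    (hM : α * (Fintype.card V : ℝ) ^ 3 < (M : ℝ)) (hG : G.IsTree) : IsRE α M G := by
  rintro ⟨u, v, huv, hi⟩
  exact not_reachable_removeEdge hG huv
    ((connected_of_improves hα hM hG.connected hi).preconnected u v)

end TreeLemmas

/-! ### Counting in complete binary trees -/

section BinaryTrees

instance (d : ℕ) : Finite (BinNode d) :=
  (List.finite_length_le Bool d).to_subtype

noncomputable instance (d : ℕ) : Fintype (BinNode d) := Fintype.ofFinite _

/-- A word is empty, or it has a last letter. -/
def binNodeSuccEquiv (d : ℕ) : BinNode (d + 1) ≃ Option (Bool × BinNode d) where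
  toFun x := match x with
    | ⟨[], _⟩ => none
    | ⟨b :: l, h⟩ => some (b, ⟨l, by simpa using h⟩)
  invFun y := match y with
    | none => ⟨[], by simp⟩
    | some (b, l) => ⟨b :: l.1, by simpa using l.2⟩
  left_inv := by
    rintro ⟨_ | ⟨b, l⟩, h⟩ <;> rfl
  right_inv := by
    rintro (_ | ⟨b, l⟩) <;> rfl

theorem sum_binNode_succ (d : ℕ) (f : ℕ → ℕ) :
    ∑ x : BinNode (d + 1), f x.1.length = f 0 + 2 * ∑ x : BinNode d, f (x.1.length + 1) := by
  rw [← (binNodeSuccEquiv d).symm.sum_comp, Fintype.sum_option, Fintype.sum_prod_type]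
  simp [binNodeSuccEquiv, two_mul]

theorem binNode_zero_eq (x : BinNode 0) : x = ⟨[], le_rfl⟩ := by
  obtain ⟨l, hl⟩ := x
  simpa using hl

instance : Unique (BinNode 0) := ⟨⟨⟨[], le_rfl⟩⟩, binNode_zero_eq⟩

theorem card_binNode (d : ℕ) : Fintype.card (BinNode d) + 1 = 2 ^ (d + 1) := by
  induction d with
  | zero => simp
  | succ d ih =>
    have := sum_binNode_succ d fun _ => 1
    simp only [Finset.sum_const, card_univ, smul_eq_mul, mul_one] at this
    rw [this, pow_succ, ← ih]
    ring

theorem sum_length_binNode (d : ℕ) :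
    ∑ x : BinNode d, (x.1.length + 1) = d * 2 ^ (d + 1) + 1 := by
  induction d with
  | zero => simp; rfl
  | succ d ih =>
    rw [sum_binNode_succ d fun i => i + 1, Finset.sum_add_distrib, ih, Finset.sum_const, card_univ,
      smul_eq_mul, mul_one, pow_succ _ (d + 1), ← card_binNode d]
    ring

/-- The nodes concentrate near the leaves, so the mean level in the star is at least `d`; the `+ 1`
is the edge to the centre. -/
theorem mul_card_binNode_le (d : ℕ) :
    d * Fintype.card (BinNode d) ≤ ∑ x : BinNode d, (x.1.length + 1) := by
  rw [sum_length_binNode, ← card_binNode]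
  nlinarith

/-- Lets the largest distance an agent can save be bounded by `|T|`, so that total savings stay
below `|T|² ≤ α`. -/
theorem two_mul_add_one_le_card_binNode {d : ℕ} (hd : 1 ≤ d) :
    2 * d + 1 ≤ Fintype.card (BinNode d) := by
  induction d, hd using Nat.le_induction with
  | base =>
    have := card_binNode 1
    omega
  | succ d hd ih =>
    have h1 := card_binNode d
    have h2 := card_binNode (d + 1)
    rw [pow_succ] at h2
    omega

end BinaryTrees

/-! ### The star of binary trees is a costly equilibrium -/

section BinaryStar

/-- Nodes of a root with `m` copies of the complete binary tree of depth `d` as child subtrees. -/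
abbrev StarNode (d m : ℕ) : Type := Option (Fin m × BinNode d)

/-- The first node is the parent of the second one. -/
def IsParent {d m : ℕ} : StarNode d m → StarNode d m → Prop
  | _, none => False
  | none, some (_, x) => x.1 = []
  | some (i, x), some (j, y) => i = j ∧ BinChild x y

/-- A root with `m` copies of the complete binary tree of depth `d` as child subtrees. -/
def binStar (d m : ℕ) : SimpleGraph (StarNode d m) :=
  SimpleGraph.fromRel IsParent

variable {d m : ℕ}

/-- Distance from the root. -/
def level : StarNode d m → ℕ
  | none => 0
  | some (_, x) => x.1.length + 1

/-- The copy of the binary tree that contains a node. -/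
def block (a : StarNode d m) : Option (Fin m) := a.map Prod.fst

theorem level_of_isParent {a b : StarNode d m} (h : IsParent a b) : level b = level a + 1 := by
  rcases a with _ | ⟨i, x⟩ <;> rcases b with _ | ⟨j, y⟩
  · exact h.elim
  · have hy : y.1 = [] := h
    simp [level, hy]
  · exact h.elim
  · obtain ⟨-, b, hb⟩ := h
    simp [level, hb]

theorem block_of_isParent {a b : StarNode d m} (h : IsParent a b) :
    level a = 0 ∨ block a = block b := by
  rcases a with _ | ⟨i, x⟩ <;> rcases b with _ | ⟨j, y⟩
  · exact h.elim
  · exact Or.inl rfl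
  · exact h.elim
  · exact Or.inr (by simp [block, h.1])

theorem isParent_unique {a b c : StarNode d m} (ha : IsParent a c) (hb : IsParent b c) :
    a = b := by
  rcases a with _ | ⟨i, x⟩ <;> rcases b with _ | ⟨j, y⟩ <;> rcases c with _ | ⟨k, z⟩ <;>
    simp only [IsParent, BinChild] at ha hb
  · rfl
  · simp [ha] at hb
  · simp [hb] at ha
  · obtain ⟨rfl, b, hx⟩ := ha
    obtain ⟨rfl, c, hy⟩ := hb
    rw [hx] at hy
    simp only [List.cons.injEq] at hy
    rw [Subtype.ext hy.2]

theorem exists_isParent {b : StarNode d m} (hb : b ≠ none) : ∃ a, IsParent a b := by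
  rcases b with _ | ⟨i, ⟨_ | ⟨c, l⟩, hl⟩⟩
  · exact absurd rfl hb
  · exact ⟨none, rfl⟩
  · exact ⟨some (i, ⟨l, by simp at hl; omega⟩), rfl, c, rfl⟩

theorem binStar_adj {a b : StarNode d m} :
    (binStar d m).Adj a b ↔ IsParent a b ∨ IsParent b a := by
  rw [binStar, fromRel_adj]
  refine ⟨And.right, fun h => ⟨?_, h⟩⟩
  rintro rfl
  rcases h with h | h <;> simpa using level_of_isParent h

theorem level_le (a : StarNode d m) : level a ≤ d + 1 := by
  rcases a with _ | ⟨i, x⟩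
  · simp [level]
  · simpa [level] using x.2

theorem level_eq_zero {a : StarNode d m} : level a = 0 ↔ a = none := by
  rcases a with _ | ⟨i, x⟩ <;> simp [level]

theorem exists_walk_root (a : StarNode d m) :
    ∃ p : (binStar d m).Walk a none, p.length = level a := by
  induction hn : level a generalizing a with
  | zero =>
    rw [level_eq_zero] at hn
    subst hn
    exact ⟨Walk.nil, rfl⟩
  | succ n ih =>
    have ha : a ≠ none := by
      rintro rfl
      simp [level] at hn
    obtain ⟨b, hb⟩ := exists_isParent ha
    have := level_of_isParent hb
    obtain ⟨p, hp⟩ := ih b (by omega)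
    exact ⟨Walk.cons (binStar_adj.2 (Or.inr hb)) p, by simp [hp]⟩

theorem binStar_connected : (binStar d m).Connected :=
  ⟨fun a b => (exists_walk_root a).choose.reachable.trans (exists_walk_root b).choose.reachable.symm⟩

theorem dist_le_level_add_level (a b : StarNode d m) :
    (binStar d m).dist a b ≤ level a + level b := by
  obtain ⟨p, hp⟩ := exists_walk_root a
  obtain ⟨q, hq⟩ := exists_walk_root b
  have := SimpleGraph.dist_le (p.append q.reverse)
  simpa [hp, hq] using this

theorem dist_of_block_ne {a b : StarNode d m} (h : block a ≠ block b) :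
    (binStar d m).dist a b = level a + level b := by
  classical
  refine le_antisymm (dist_le_level_add_level a b) ?_
  have key := le_add_dist_of_lipschitz (G := binStar d m)
    -- Signed level: negative on the copy of `a`, positive elsewhere. The signs agree at the centre,
    -- the only passage between copies.
    (f := fun x => if block x = block a then -(level x : ℤ) else level x) (u := a) (v := b) ?_
    (binStar_connected.preconnected a b)
  · simp only [if_true, if_neg (Ne.symm h)] at key
    omega
  · intro x y hxy
    rw [binStar_adj] at hxy
    rcases hxy with hxy | hxy
    · have h1 := level_of_isParent hxy
      rcases block_of_isParent hxy with h2 | h2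
      · simp only [h1, h2]
        split_ifs <;> simp
      · rw [h2, h1]
        split_ifs <;> push_cast <;> linarith
    · have h1 := level_of_isParent hxy
      rcases block_of_isParent hxy with h2 | h2
      · simp only [h1, h2]
        split_ifs <;> simp
      · rw [h2, h1]
        split_ifs <;> push_cast <;> linarith

/-- Each edge joins a non-root node to its unique parent, so there are at most `n - 1` edges. -/
theorem isTree_binStar : (binStar d m).IsTree := by
  classical
  rw [isTree_iff_connected_and_card]
  refine ⟨binStar_connected, le_antisymm ?_ binStar_connected.card_vert_le_card_edgeSet_add_one⟩
  have hpar : ∀ b : StarNode d m, ∃ a, b ≠ none → IsParent a b := by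
    intro b
    by_cases hb : b = none
    · exact ⟨none, fun h => absurd hb h⟩
    · obtain ⟨a, ha⟩ := exists_isParent hb
      exact ⟨a, fun _ => ha⟩
  choose par hpar using hpar
  have hsub : (binStar d m).edgeSet ⊆ (fun b => s(par b, b)) '' {none}ᶜ := by
    intro e he
    induction e with
    | h a b =>
    have key : ∀ a b : StarNode d m, IsParent a b → s(a, b) ∈ (fun b => s(par b, b)) '' {none}ᶜ := by
      intro a b hab
      have hb : b ≠ none := by
        rintro rfl
        rcases a with _ | a <;> exact hab.elim
      exact ⟨b, hb, by rw [isParent_unique hab (hpar b hb)]⟩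
    rw [mem_edgeSet, binStar_adj] at he
    rcases he with h | h
    · exact key a b h
    · rw [Sym2.eq_swap]
      exact key b a h
  have h1 := (Set.ncard_le_ncard hsub (Set.toFinite _)).trans (Set.ncard_image_le (Set.toFinite _))
  rw [Set.ncard_compl, Set.ncard_singleton] at h1
  rw [Nat.card_coe_set_eq]
  have : 0 < Nat.card (StarNode d m) := Nat.card_pos
  omega

theorem card_starNode :
    Fintype.card (StarNode d m) = m * Fintype.card (BinNode d) + 1 := by
  simp

theorem card_filter_block {a : StarNode d m} (ha : a ≠ none) :
    (univ.filter fun x : StarNode d m => block x = block a).card = Fintype.card (BinNode d) := by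
  rcases a with _ | ⟨i, y⟩
  · exact absurd rfl ha
  · rw [← card_univ, ← Finset.card_map ⟨fun x : BinNode d => (some (i, x) : StarNode d m), by
      intro x y h
      simpa using h⟩]
    congr 1
    ext x
    rw [mem_filter, Finset.mem_map]
    rcases x with _ | ⟨j, z⟩
    · simp [block]
    · constructor
      · intro h
        have hji : j = i := by simpa [block] using h.2
        exact ⟨z, mem_univ z, by rw [hji]; rfl⟩
      · rintro ⟨z', -, h⟩
        have h' : (some (i, z') : StarNode d m) = some (j, z) := h
        have hij : i = j := Option.some.inj (congrArg block h')
        exact ⟨mem_univ _, by simp [block, hij]⟩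

/-- The nodes of copy `i` below the node with word `z`. -/
def descendants (i : Fin m) (z : List Bool) : Set (StarNode d m) :=
  {a | ∃ x : BinNode d, a = some (i, x) ∧ z <:+ x.1}

theorem ncard_descendants (i : Fin m) (z : BinNode d) :
    (descendants i z.1 : Set (StarNode d m)).ncard = Fintype.card (BinNode (d - z.1.length)) := by
  have hz := z.2
  let f : BinNode (d - z.1.length) → StarNode d m := fun s =>
    some (i, ⟨s.1 ++ z.1, by have := s.2; simp only [List.length_append]; omega⟩)
  have hf : Function.Injective f := by
    intro s t h
    simpa [f, Subtype.ext_iff] using h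
  have hr : descendants i z.1 = Set.range f := by
    ext a
    constructor
    · rintro ⟨x, rfl, s, hs⟩
      have := congrArg List.length hs
      have hx := x.2
      simp only [List.length_append] at this
      exact ⟨⟨s, by omega⟩, by simp [f, hs]⟩
    · rintro ⟨s, rfl⟩
      exact ⟨_, rfl, s.1, rfl⟩
  rw [hr, ← Nat.card_coe_set_eq, Nat.card_range_of_injective hf, Nat.card_eq_fintype_card]

theorem card_side_of_isParent {a : StarNode d m} {i : Fin m} {z : BinNode d}
    (h : IsParent a (some (i, z))) :
    (side (binStar d m) a (some (i, z))).card = Fintype.card (BinNode (d - z.1.length)) := by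
  rw [← ncard_descendants i z, ← Set.ncard_coe_finset]
  congr 1
  refine coe_side_eq isTree_binStar (binStar_adj.2 (Or.inl h)) ⟨z, rfl, List.suffix_rfl⟩ ?_ ?_
  · rintro ⟨x, rfl, hx⟩
    have h1 := level_of_isParent h
    have h2 := hx.length_le
    simp only [level] at h1
    omega
  · rintro b c hbc ⟨x, rfl, hx⟩ hc
    rw [binStar_adj] at hbc
    rcases hbc with hbc | hbc
    · rcases c with _ | ⟨j, y⟩
      · exact hbc.elim
      · obtain ⟨rfl, e, he⟩ := hbc
        exact absurd ⟨y, rfl, he ▸ hx.trans (List.suffix_cons _ _)⟩ hc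
    · have hxz : x = z := by
        rcases c with _ | ⟨j, y⟩
        · have hx0 : x.1 = [] := hbc
          rw [hx0] at hx
          exact Subtype.ext (hx0.trans (List.suffix_nil.1 hx).symm)
        · obtain ⟨rfl, e, he⟩ := hbc
          rw [he, List.suffix_cons_iff] at hx
          rcases hx with hx | hx
          · exact Subtype.ext (he.trans hx.symm)
          · exact absurd ⟨y, rfl, hx⟩ hc
      subst hxz
      exact ⟨rfl, isParent_unique hbc h⟩

/-- The root of a subtree is a median of it: the child subtree containing `w` is balanced by its
sibling's. -/
theorem sum_dist_le_of_isParent {u v w : StarNode d m} (huv : IsParent u v)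
    (hw : w ∈ side (binStar d m) u v) (hwv : w ≠ v) :
    ∑ y ∈ side (binStar d m) u v, ((binStar d m).dist v y : ℝ)
      ≤ ∑ y ∈ side (binStar d m) u v, ((binStar d m).dist w y : ℝ) := by
  classical
  have hT : (binStar d m).IsTree := isTree_binStar
  have hadj : (binStar d m).Adj u v := binStar_adj.2 (Or.inl huv)
  obtain ⟨z, hvz, hz⟩ := exists_adj_dist_add_one hT.connected (Ne.symm hwv)
  have hzu : z ≠ u := by
    rintro rfl
    have h1 := dist_of_mem_side hT.connected hadj hw
    rw [SimpleGraph.dist_comm, SimpleGraph.dist_comm (u := w)] at h1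
    omega
  have hpar : IsParent v z := by
    rcases binStar_adj.1 hvz with h | h
    · exact h
    · exact absurd (isParent_unique h huv) hzu
  rcases v with _ | ⟨i, x⟩
  · rcases u with _ | u <;> exact huv.elim
  rcases z with _ | ⟨j, z⟩
  · exact hpar.elim
  obtain ⟨rfl, b, hb⟩ := id hpar
  -- The sibling of `z`: the head of a word is its last branching choice, so flip it.
  let z' : BinNode d := ⟨(!b) :: x.1, by have := z.2; rw [hb] at this; simpa using this⟩
  have hpar' : IsParent (some (i, x)) (some (i, z') : StarNode d m) := ⟨rfl, !b, rfl⟩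
  have hvz' : (binStar d m).Adj (some (i, x)) (some (i, z')) := binStar_adj.2 (Or.inl hpar')
  have hne : (some (i, z') : StarNode d m) ≠ some (i, z) := by
    intro h
    have h1 : z' = z := by simpa using h
    have h2 := congrArg Subtype.val h1
    rw [hb] at h2
    simp [z'] at h2
  have hlev := level_of_isParent huv
  have hlev1 := level_of_isParent hpar
  have hlev2 := level_of_isParent hpar'
  have hself := self_mem_side hadj
  have hsub : ∀ y, IsParent (some (i, x)) y →
      side (binStar d m) (some (i, x)) y ⊆ side (binStar d m) u (some (i, x)) := by
    intro y hy
    refine side_subset_side hT hadj (binStar_adj.2 (Or.inl hy)) hself ?_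
    rw [mem_side, dist_eq_one_iff_adj.2 hadj, Nat.lt_one_iff, hT.connected.dist_eq_zero_iff]
    rintro rfl
    have := level_of_isParent hy
    omega
  refine sum_dist_le_of_card_side_le hT hvz ?_ (hsub _ hpar) ?_
  · rw [mem_side, SimpleGraph.dist_comm, SimpleGraph.dist_comm (u := w)]
    omega
  · have hcard : (side (binStar d m) (some (i, x)) (some (i, z))).card
        = (side (binStar d m) (some (i, x)) (some (i, z'))).card := by
      rw [card_side_of_isParent hpar, card_side_of_isParent hpar', hb]
      simp [z']
    rw [hcard]
    refine Finset.card_le_card fun y hy => ?_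
    rw [Finset.mem_sdiff]
    refine ⟨hsub _ hpar' hy, fun hy2 => ?_⟩
    have hz' : (some (i, z') : StarNode d m) ∉ side (binStar d m) (some (i, x)) (some (i, z)) :=
      fun h => hne (eq_of_adj_of_mem_side hT hvz hvz'.symm h (notMem_side _ _)).1
    have e1 := dist_of_mem_of_notMem hT hvz hy2 hz'
    have e2 := dist_of_mem_side hT.connected hvz' hy
    have e3 := dist_of_mem_side hT.connected hvz hy2
    omega

theorem isBSwE_binStar {α : ℝ} (hα : 1 ≤ α) {M : ℕ} (hd : 1 ≤ d)
    (hN : (Fintype.card (BinNode d) : ℝ) ^ 2 ≤ α)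
    (hM : α * (Fintype.card (StarNode d m) : ℝ) ^ 3 < (M : ℝ)) : IsBSwE α M (binStar d m) := by
  classical
  have hT : (binStar d m).IsTree := isTree_binStar
  rintro ⟨u, v, w, huv, -, huw, hiu, hiw⟩
  have hwS : w ∈ side (binStar d m) u v := by
    by_contra h
    exact not_connected_rejoin hT huv (notMem_side u v) h
      (connected_of_improves hα hM hT.connected hiu)
  have hwv : w ≠ v := by
    rintro rfl
    exact huw huv
  rw [improves_swap_left_iff hT huv hwS hwv] at hiu
  rw [improves_swap_right_iff hT huv hwS hwv, side_compl hT huv] at hiw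
  rcases binStar_adj.1 huv with hp | hp
  · exact absurd (sum_dist_le_of_isParent hp hwS hwv) (not_le.2 hiu)
  -- Here `u` swaps away its parent `v`. Then `w` moves closer only to the subtree of `u`, which
  -- lies in one copy.
  · have hlev := level_of_isParent hp
    have h1 : (side (binStar d m) v u).card ≤ Fintype.card (BinNode d) := by
      have hu : u ≠ none := by
        rw [Ne, ← level_eq_zero]
        omega
      rw [← card_filter_block hu]
      refine Finset.card_le_card fun x hx => ?_
      rw [mem_filter]
      refine ⟨mem_univ x, ?_⟩
      by_contra hb
      have e1 := dist_of_block_ne hb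
      have e2 := dist_le_level_add_level x v
      rw [mem_side] at hx
      omega
    have h2 : (binStar d m).dist w v ≤ Fintype.card (BinNode d) := by
      have e1 := dist_of_mem_side hT.connected huv hwS
      have e2 := dist_le_level_add_level w u
      have e3 := level_le w
      have e4 := level_le u
      have e5 := two_mul_add_one_le_card_binNode hd
      omega
    have h3 : ((binStar d m).dist w v : ℝ) * ((side (binStar d m) v u).card : ℝ)
        ≤ (Fintype.card (BinNode d) : ℝ) * Fintype.card (BinNode d) := by
      gcongr
    nlinarith

/-- The endpoint nearer the centre saves nothing outside the copy of `v`, since going via `v` is no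
shorter; inside it, at most `|T|` for each of `|T|` nodes. -/
theorem not_improves_addEdge_binStar {α : ℝ} {M : ℕ} (hd : 1 ≤ d)
    (hN : (Fintype.card (BinNode d) : ℝ) ^ 2 ≤ α)
    {u v : StarNode d m} (huv : u ≠ v) (hadj : ¬ (binStar d m).Adj u v)
    (hlev : level u ≤ level v) :
    ¬ Improves α M (binStar d m) (addEdge (binStar d m) u v) u := by
  classical
  have hT : (binStar d m).IsTree := isTree_binStar
  have hc : (addEdge (binStar d m) u v).Connected := hT.connected.mono le_sup_left
  rw [Improves, agentCost_of_connected hc, agentCost_of_connected hT.connected, not_lt]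
  have hv : v ≠ none := by
    rintro rfl
    have : level u = 0 := by simpa [level] using hlev
    exact huv (level_eq_zero.1 this)
  have hdeg : ((addEdge (binStar d m) u v).neighborSet u).ncard
      = ((binStar d m).neighborSet u).ncard + 1 := by
    have h1 : (addEdge (binStar d m) u v).neighborSet u
        = insert v ((binStar d m).neighborSet u) := by
      ext x
      simp only [mem_neighborSet, addEdge_adj, Set.mem_insert_iff]
      grind
    rw [h1, Set.ncard_insert_of_notMem (by simpa using hadj) (Set.toFinite _)]
  have hsum : ∑ x, ((binStar d m).dist u x : ℝ) ≤ ∑ x, (((addEdge (binStar d m) u v).dist u x : ℝ)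
      + if block x = block v then (Fintype.card (BinNode d) : ℝ) else 0) := by
    refine Finset.sum_le_sum fun x _ => ?_
    have h1 := min_le_dist_addEdge (G := binStar d m) hT.connected (u := u) (v := v) x
    split_ifs with hb
    · have e1 := hT.connected.dist_triangle (u := u) (v := v) (w := x)
      have e2 := dist_le_level_add_level u v
      have e3 := level_le u
      have e4 := level_le v
      have e5 := two_mul_add_one_le_card_binNode hd
      have : (binStar d m).dist u x
          ≤ (addEdge (binStar d m) u v).dist u x + Fintype.card (BinNode d) := by omega
      exact_mod_cast this
    · have e1 := dist_of_block_ne (Ne.symm hb)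
      have e2 := dist_le_level_add_level u x
      have : (binStar d m).dist u x ≤ (addEdge (binStar d m) u v).dist u x := by omega
      rw [add_zero]
      exact_mod_cast this
  rw [Finset.sum_add_distrib, ← Finset.sum_filter, Finset.sum_const, card_filter_block hv,
    nsmul_eq_mul] at hsum
  rw [hdeg]
  push_cast
  nlinarith

theorem isBAE_binStar {α : ℝ} {M : ℕ} (hd : 1 ≤ d)
    (hN : (Fintype.card (BinNode d) : ℝ) ^ 2 ≤ α) : IsBAE α M (binStar d m) := by
  rintro ⟨u, v, huv, hadj, hiu, hiv⟩
  rcases le_total (level u) (level v) with h | h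
  · exact not_improves_addEdge_binStar hd hN huv hadj h hiu
  · rw [addEdge_comm] at hiv
    exact not_improves_addEdge_binStar hd hN huv.symm (fun h => hadj h.symm) h hiv

theorem isBGE_binStar {α : ℝ} (hα : 1 ≤ α) {M : ℕ} (hd : 1 ≤ d)
    (hN : (Fintype.card (BinNode d) : ℝ) ^ 2 ≤ α)
    (hM : α * (Fintype.card (StarNode d m) : ℝ) ^ 3 < (M : ℝ)) : IsBGE α M (binStar d m) :=
  ⟨⟨isRE_of_isTree hα hM isTree_binStar, isBAE_binStar hd hN⟩,
    isBSwE_binStar hα hd hN hM⟩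

theorem mul_le_sum_level :
    (d : ℝ) * ((Fintype.card (StarNode d m) : ℝ) - 1) ≤ ∑ a : StarNode d m, (level a : ℝ) := by
  have h1 : ∑ a : StarNode d m, level a = m * ∑ x : BinNode d, (x.1.length + 1) := by
    rw [Fintype.sum_option, Fintype.sum_prod_type]
    simp [level]
  have h2 : d * (m * Fintype.card (BinNode d)) ≤ ∑ a : StarNode d m, level a := by
    rw [h1, mul_left_comm]
    exact Nat.mul_le_mul_left m (mul_card_binNode_le d)
  rw [card_starNode]
  have h3 : ((d * (m * Fintype.card (BinNode d)) : ℕ) : ℝ) ≤ ((∑ a : StarNode d m, level a : ℕ) : ℝ) :=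
    Nat.cast_le.2 h2
  push_cast at h3 ⊢
  linarith

/-- Count only pairs in different copies, at distance `level a + level b`; by symmetry each level is
counted twice for every node outside its own copy. -/
theorem le_socialCost_binStar {α : ℝ} (hα : 0 ≤ α) {M : ℕ}
    (hm : Fintype.card (BinNode d) ≤ Fintype.card (StarNode d m)) :
    2 * ((Fintype.card (StarNode d m) : ℝ) - 1) *
      (d * ((Fintype.card (StarNode d m) : ℝ) - Fintype.card (BinNode d)))
      ≤ socialCost α M (binStar d m) := by
  classical
  set n : ℝ := (Fintype.card (StarNode d m) : ℝ) with hn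
  set N : ℝ := (Fintype.card (BinNode d) : ℝ) with hN
  have hnN : 0 ≤ n - N := sub_nonneg.2 (Nat.cast_le.2 hm)
  rw [socialCost_of_connected binStar_connected]
  have h0 : 0 ≤ 2 * α * (Nat.card (binStar d m).edgeSet : ℝ) := by positivity
  have h1 : ∑ a : StarNode d m, ∑ b : StarNode d m,
      ((if block a ≠ block b then (level a : ℝ) else 0)
        + if block a ≠ block b then (level b : ℝ) else 0)
      ≤ ∑ a, ∑ b, ((binStar d m).dist a b : ℝ) := by
    refine Finset.sum_le_sum fun a _ => Finset.sum_le_sum fun b _ => ?_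
    split_ifs with h
    · rw [dist_of_block_ne h]
      push_cast
      exact le_rfl
    · simp
  have h2 : ∑ a : StarNode d m, ∑ b : StarNode d m,
      (if block a ≠ block b then (level b : ℝ) else 0)
      = ∑ a : StarNode d m, ∑ b : StarNode d m,
        (if block a ≠ block b then (level a : ℝ) else 0) := by
    rw [Finset.sum_comm]
    simp only [ne_comm]
  have h3 : ∑ a : StarNode d m, (level a : ℝ) * (n - N) ≤ ∑ a : StarNode d m, ∑ b : StarNode d m,
      (if block a ≠ block b then (level a : ℝ) else 0) := by
    refine Finset.sum_le_sum fun a _ => ?_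
    by_cases ha : a = none
    · subst ha
      simp [level]
    · have e1 := Finset.card_filter_add_card_filter_not (s := (univ : Finset (StarNode d m)))
        (fun x => block x = block a)
      rw [card_filter_block ha, card_univ] at e1
      rw [← Finset.sum_filter, Finset.sum_const, nsmul_eq_mul, mul_comm]
      have e2 : (univ.filter fun b : StarNode d m => block a ≠ block b).card
          = (univ.filter fun x : StarNode d m => ¬ block x = block a).card := by
        simp only [ne_eq, eq_comm]
      have e3 : N + ((univ.filter fun b : StarNode d m => block a ≠ block b).card : ℝ) = n := by
        rw [e2, hn, hN]
        exact_mod_cast e1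
      rw [← e3]
      simp
  simp only [Finset.sum_add_distrib] at h1
  rw [h2] at h1
  rw [← Finset.sum_mul] at h3
  have h4 := mul_le_mul_of_nonneg_right (mul_le_sum_level (d := d) (m := m)) hnN
  linarith

end BinaryStar

end BNCG

namespace BNCG

open Finset SimpleGraph

/-! ### Invariance under isomorphism -/

section Transfer

variable {V W : Type*}

theorem dist_le_of_iso {G : SimpleGraph V} {H : SimpleGraph W} (φ : G ≃g H)
    {u v : V} (h : G.Reachable u v) : H.dist (φ u) (φ v) ≤ G.dist u v := by
  obtain ⟨p, hp⟩ := h.exists_walk_length_eq_dist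
  rw [← hp, ← Walk.length_map φ.toHom p]
  exact SimpleGraph.dist_le _

variable [Fintype V] [Fintype W]

theorem hopDist_iso {M : ℕ} {G : SimpleGraph V} {H : SimpleGraph W} (φ : G ≃g H)
    (u v : V) : hopDist M H (φ u) (φ v) = hopDist M G u v := by
  unfold hopDist
  by_cases h : G.Reachable u v
  · have h' : H.Reachable (φ u) (φ v) := φ.reachable_iff.2 h
    rw [if_pos h, if_pos h']
    refine le_antisymm (dist_le_of_iso φ h) ?_
    simpa using dist_le_of_iso φ.symm h'
  · rw [if_neg h, if_neg fun h' => h (φ.reachable_iff.1 h')]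

theorem agentCost_iso {α : ℝ} {M : ℕ} {G : SimpleGraph V} {H : SimpleGraph W} (φ : G ≃g H)
    (u : V) : agentCost α M H (φ u) = agentCost α M G u := by
  unfold agentCost
  have h1 : (H.neighborSet (φ u)).ncard = (G.neighborSet u).ncard := by
    rw [← Set.ncard_image_of_injective (G.neighborSet u) φ.injective]
    congr 1
    ext v
    simp only [mem_neighborSet, Set.mem_image]
    constructor
    · intro h
      refine ⟨φ.symm v, ?_, by simp⟩
      rw [← φ.map_adj_iff]
      simpa using h
    · rintro ⟨x, hx, rfl⟩
      exact φ.map_adj_iff.2 hx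
  have h2 : ∑ v, (hopDist M H (φ u) v : ℝ) = ∑ v, (hopDist M G u v : ℝ) := by
    rw [← φ.toEquiv.sum_comp]
    exact Finset.sum_congr rfl fun v _ => by rw [← hopDist_iso φ u v]; rfl
  rw [h1, h2]

theorem improves_iso {α : ℝ} {M : ℕ} {G G' : SimpleGraph V} {H H' : SimpleGraph W} (φ : G ≃g H)
    (h : ∀ a b, H'.Adj (φ a) (φ b) ↔ G'.Adj a b) {u : V} (hi : Improves α M G G' u) :
    Improves α M H H' (φ u) := by
  let ψ : G' ≃g H' := ⟨φ.toEquiv, h _ _⟩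
  unfold Improves at hi ⊢
  rw [agentCost_iso φ, show φ u = ψ u from rfl, agentCost_iso ψ]
  exact hi

theorem isBGE_iso {α : ℝ} {M : ℕ} {G : SimpleGraph V} {H : SimpleGraph W} (φ : G ≃g H)
    (hH : IsBGE α M H) : IsBGE α M G := by
  refine ⟨⟨?_, ?_⟩, ?_⟩
  · rintro ⟨u, v, huv, hi⟩
    refine hH.1.1 ⟨φ u, φ v, φ.map_adj_iff.2 huv, improves_iso φ (fun a b => ?_) hi⟩
    simp [removeEdge_adj, φ.map_adj_iff]
  · rintro ⟨u, v, hne, huv, hi, hj⟩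
    have h : ∀ a b, (addEdge H (φ u) (φ v)).Adj (φ a) (φ b) ↔ (addEdge G u v).Adj a b := by
      simp [addEdge_adj, φ.map_adj_iff]
    exact hH.1.2 ⟨φ u, φ v, φ.injective.ne hne, fun h => huv (φ.map_adj_iff.1 h),
      improves_iso φ h hi, improves_iso φ h hj⟩
  · rintro ⟨u, v, w, huv, hne, huw, hi, hj⟩
    have h : ∀ a b, (addEdge (removeEdge H (φ u) (φ v)) (φ u) (φ w)).Adj (φ a) (φ b) ↔
        (addEdge (removeEdge G u v) u w).Adj a b := by
      simp [addEdge_adj, removeEdge_adj, φ.map_adj_iff]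
    exact hH.2 ⟨φ u, φ v, φ w, φ.map_adj_iff.2 huv, φ.injective.ne hne,
      fun h => huw (φ.map_adj_iff.1 h), improves_iso φ h hi, improves_iso φ h hj⟩

theorem socialCost_iso {α : ℝ} {M : ℕ} {G : SimpleGraph V} {H : SimpleGraph W} (φ : G ≃g H) :
    socialCost α M G = socialCost α M H := by
  unfold socialCost
  rw [← φ.toEquiv.sum_comp]
  exact Finset.sum_congr rfl fun v _ => (agentCost_iso φ v).symm

end Transfer

/-! ### Stretch factor one gives complete binary trees -/

section StretchOne

/-- The node of the complete binary tree that a node of its `1`-stretching stands for. -/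
def unstretch {d : ℕ} : StretchedNode d 1 → BinNode d
  | none => ⟨[], Nat.zero_le d⟩
  | some (u, _) => u.1

theorem unstretch_bijective (d : ℕ) : Function.Bijective (unstretch (d := d)) := by
  constructor
  · rintro (_ | ⟨⟨u, hu⟩, i⟩) (_ | ⟨⟨v, hv⟩, j⟩) h
    · rfl
    · exact absurd (congrArg Subtype.val h).symm hv
    · exact absurd (congrArg Subtype.val h) hu
    · have : u = v := h
      subst this
      rw [Subsingleton.elim i j]
  · intro x
    by_cases hx : x.1 = []
    · exact ⟨none, Subtype.ext hx.symm⟩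
    · exact ⟨some (⟨x, hx⟩, 0), rfl⟩

theorem stretchedChild_iff {d : ℕ} (x y : StretchedNode d 1) :
    StretchedChild x y ↔ BinChild (unstretch x) (unstretch y) := by
  rcases x with _ | ⟨u, i⟩ <;> rcases y with _ | ⟨v, j⟩ <;>
    simp [StretchedChild, unstretch, BinChild]

theorem not_binChild_self {d : ℕ} (x : BinNode d) : ¬ BinChild x x := by
  rintro ⟨b, h⟩
  simpa using congrArg List.length h

theorem stretchedTree_adj {d : ℕ} {x y : StretchedNode d 1} :
    (stretchedTree d 1).Adj x y ↔
      BinChild (unstretch x) (unstretch y) ∨ BinChild (unstretch y) (unstretch x) := by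
  rw [stretchedTree, fromRel_adj, stretchedChild_iff, stretchedChild_iff]
  refine ⟨And.right, fun h => ⟨?_, h⟩⟩
  rintro rfl
  rcases h with h | h <;> exact not_binChild_self _ h

/-- With stretch factor `1`, a stretched tree star is a star of complete binary trees. -/
noncomputable def treeStarIso (d m : ℕ) : treeStar d 1 m ≃g binStar d m where
  toEquiv := Equiv.optionCongr
    (Equiv.prodCongr (Equiv.refl _) (Equiv.ofBijective unstretch (unstretch_bijective d)))
  map_rel_iff' := by
    intro a b
    rw [binStar_adj, treeStar, fromRel_adj]
    rcases a with _ | ⟨i, x⟩ <;> rcases b with _ | ⟨j, y⟩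
    · simp [IsParent]
    · have : (unstretch y).1 = [] ↔ y = none := by
        rw [← (unstretch_bijective d).1.eq_iff, Subtype.ext_iff]
        rfl
      simp [IsParent, StarRel, this]
    · have : (unstretch x).1 = [] ↔ x = none := by
        rw [← (unstretch_bijective d).1.eq_iff, Subtype.ext_iff]
        rfl
      simp [IsParent, StarRel, this]
    · have h1 : (stretchedTree d 1).Adj y x ↔ (stretchedTree d 1).Adj x y := adj_comm _ _ _
      simp only [IsParent, StarRel, Equiv.optionCongr_apply, Option.map_some, Equiv.prodCongr_apply,
        Prod.map, Equiv.refl_apply, Equiv.ofBijective_apply, h1, stretchedTree_adj, ne_eq]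
      have h2 : ¬ BinChild (unstretch x) (unstretch x) := not_binChild_self _
      constructor
      · rintro (⟨rfl, h⟩ | ⟨rfl, h⟩)
        · refine ⟨?_, Or.inl ⟨rfl, Or.inl h⟩⟩
          intro h3
          simp only [Option.some.injEq, Prod.mk.injEq, true_and] at h3
          rw [h3] at h
          exact not_binChild_self _ h
        · refine ⟨?_, Or.inl ⟨rfl, Or.inr h⟩⟩
          intro h3
          simp only [Option.some.injEq, Prod.mk.injEq, true_and] at h3
          rw [h3] at h
          exact not_binChild_self _ h
      · rintro ⟨-, ⟨rfl, h⟩ | ⟨rfl, h⟩⟩ <;> tauto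

theorem natCard_stretchedNode_one (d : ℕ) :
    Nat.card (StretchedNode d 1) = Fintype.card (BinNode d) := by
  rw [Nat.card_congr (Equiv.ofBijective unstretch (unstretch_bijective d)),
    Nat.card_eq_fintype_card]

theorem card_binNode_le_iff {d d' : ℕ} :
    Fintype.card (BinNode d') ≤ Fintype.card (BinNode d) ↔ d' ≤ d := by
  have h1 := card_binNode d
  have h2 := card_binNode d'
  rw [← Nat.add_le_add_iff_right (n := 1), h1, h2, Nat.pow_le_pow_iff_right (by norm_num)]
  omega

end StretchOne

/-! ### Choice of parameters and Price of Anarchy bounds -/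

section Assembly

theorem exists_depth {α : ℝ} (hα : 64 ≤ α) : ∃ d : ℕ, 1 ≤ d ∧
    2 * (Fintype.card (BinNode d) : ℝ) + 1 ≤ Real.sqrt α ∧ Real.logb 2 α / 2 - 3 ≤ d := by
  have h64 : 6 ≤ Real.logb 2 α := by
    rw [Real.le_logb_iff_rpow_le one_lt_two (by linarith)]
    norm_num
    exact hα
  -- With `d = ⌊(log α)/2⌋ - 2` one has `2|T| + 1 < 2^(d+2) ≤ √α`. Rounding costs less than 1,
  -- whence the loss of 3; `α ≥ 64` makes `d ≥ 1`.
  obtain ⟨d, hd⟩ : ∃ d, ⌊Real.logb 2 α / 2⌋₊ = d + 2 := by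
    have : 3 ≤ ⌊Real.logb 2 α / 2⌋₊ := Nat.le_floor (by push_cast; linarith)
    exact ⟨⌊Real.logb 2 α / 2⌋₊ - 2, by omega⟩
  have h1 := Nat.floor_le (by linarith : 0 ≤ Real.logb 2 α / 2)
  have h2 := Nat.lt_floor_add_one (Real.logb 2 α / 2)
  have h3 : 3 ≤ ⌊Real.logb 2 α / 2⌋₊ := Nat.le_floor (by push_cast; linarith)
  rw [hd] at h1 h2 h3
  push_cast at h1 h2
  refine ⟨d, by omega, ?_, by linarith⟩
  have h4 : (Fintype.card (BinNode d) : ℝ) + 1 = 2 ^ (d + 1) := by exact_mod_cast card_binNode d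
  have h5 : (2 : ℝ) ^ (d + 2) ≤ Real.sqrt α := by
    refine Real.le_sqrt_of_sq_le ?_
    rw [← pow_mul, ← Real.rpow_natCast, ← Real.le_logb_iff_rpow_le one_lt_two (by linarith)]
    push_cast
    linarith
  have h6 : (2 : ℝ) ^ (d + 2) = 2 * 2 ^ (d + 1) := by ring
  linarith

theorem le_costRatio_of_iso {V : Type*} [Fintype V] {d m : ℕ} {G : SimpleGraph V}
    (φ : G ≃g binStar d m) (hm : 1 ≤ m) {α : ℝ} (hα : 1 ≤ α) {M : ℕ}
    (hM : α * (Fintype.card V : ℝ) ^ 3 < (M : ℝ))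
    (hN : (Fintype.card (BinNode d) : ℝ) ^ 2 ≤ α) (hd : d ≤ Fintype.card (BinNode d))
    (hn : α ≤ Fintype.card V) : (d : ℝ) / 2 - 1 / 2 ≤ costRatio α M G := by
  have hcard : Fintype.card V = Fintype.card (StarNode d m) := Fintype.card_congr φ.toEquiv
  have hNpos : 1 ≤ Fintype.card (BinNode d) := Fintype.card_pos_iff.2 ⟨⟨[], Nat.zero_le d⟩⟩
  have hle : Fintype.card (BinNode d) + 1 ≤ Fintype.card (StarNode d m) := by
    rw [card_starNode]
    have := Nat.mul_le_mul_right (Fintype.card (BinNode d)) hm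
    omega
  have : Nonempty V := Fintype.card_pos_iff.1 (by omega)
  have hsc := le_socialCost_binStar (α := α) (by linarith) (M := M)
    (by omega : Fintype.card (BinNode d) ≤ Fintype.card (StarNode d m))
  rw [costRatio, optCost_eq hα hM, socialCost_iso φ]
  rw [hcard] at hn ⊢
  have hle' : (Fintype.card (BinNode d) : ℝ) + 1 ≤ Fintype.card (StarNode d m) := by
    exact_mod_cast hle
  have hNpos' : (1 : ℝ) ≤ Fintype.card (BinNode d) := by exact_mod_cast hNpos
  have hd' : (d : ℝ) ≤ Fintype.card (BinNode d) := by exact_mod_cast hd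
  set n : ℝ := (Fintype.card (StarNode d m) : ℝ)
  set N : ℝ := (Fintype.card (BinNode d) : ℝ)
  have hd0 : (0 : ℝ) ≤ d := by positivity
  rw [le_div_iff₀ (mul_pos (by linarith) (by linarith))]
  refine le_trans ?_ hsc
  rw [mul_left_comm]
  refine mul_le_mul_of_nonneg_left ?_ (by linarith)
  -- The loss from ignoring pairs within a copy is `dN ≤ N² ≤ α`; with `n ≥ α` this costs only the
  -- final `1/2`.
  have h1 : (d : ℝ) * N ≤ α := by nlinarith
  have h2 : 0 ≤ (d : ℝ) * (n - α) := mul_nonneg hd0 (by linarith)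
  nlinarith

theorem exists_stretchedTreeStar {α : ℝ} (hα : 64 ≤ α) {η : ℕ} (hη : α ≤ η) :
    ∃ n : ℕ, (η : ℝ) ≤ (n : ℝ) ∧ (n : ℝ) ≤ 3 * (η : ℝ) / 2 ∧
      ∃ G : SimpleGraph (Fin n), (∃ (k : ℕ) (t : ℝ), IsStretchedTreeStar k t η G) ∧ G.IsTree ∧
        ∀ M : ℕ, α * (n : ℝ) ^ 3 < (M : ℝ) → IsBGE α M G ∧ IsKBSE 2 α M G ∧
          (1 / 4 : ℝ) * Real.logb 2 α - 17 / 8 ≤ costRatio α M G := by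
  obtain ⟨d, hd1, hdN, hdlog⟩ := exists_depth hα
  have hN3 := two_mul_add_one_le_card_binNode hd1
  have hN3' : (3 : ℝ) ≤ Fintype.card (BinNode d) := by
    exact_mod_cast (by omega : 3 ≤ Fintype.card (BinNode d))
  have hcard := natCard_stretchedNode_one d
  have hsq := Real.sq_sqrt (by linarith : 0 ≤ α)
  have hdle : d ≤ Fintype.card (BinNode d) := by omega
  have hNη : 2 * (Fintype.card (BinNode d) : ℝ) + 1 ≤ η := by nlinarith
  have hN2 : (Fintype.card (BinNode d) : ℝ) ^ 2 ≤ α := by nlinarith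
  set N := Fintype.card (BinNode d) with hN
  set m := ⌈((η : ℝ) - 1) / (N : ℝ)⌉₊ with hm
  have hm1 : 1 ≤ m := Nat.one_le_ceil_iff.2 (div_pos (by linarith) (by linarith))
  have hmle : ((η : ℝ) - 1) / N ≤ m := Nat.le_ceil _
  have hmlt : (m : ℝ) < ((η : ℝ) - 1) / N + 1 :=
    Nat.ceil_lt_add_one (div_nonneg (by linarith) (by linarith))
  have hn : (Fintype.card (StarNode d m) : ℝ) = m * N + 1 := by
    rw [card_starNode]
    push_cast
    rfl
  rw [div_le_iff₀ (by linarith)] at hmle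
  have hmlt' : (m : ℝ) * N < (η - 1) + N := by
    have h1 := mul_lt_mul_of_pos_right hmlt (by linarith : (0 : ℝ) < N)
    rwa [add_mul, div_mul_cancel₀ _ (by linarith), one_mul] at h1
  let e : Fin (Fintype.card (StarNode d m)) ≃ StarNode d m := (Fintype.equivFin _).symm
  let φ : (binStar d m).comap e ≃g binStar d m := Iso.comap e _
  have hT : ((binStar d m).comap e).IsTree := φ.isTree_iff.2 isTree_binStar
  -- Target size `t = |T|` makes `d` maximal by monotonicity of `|T|` in `d`. Rounding up the number
  -- of copies gives `n < η + |T|`, and `2|T| ≤ η`.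
  refine ⟨Fintype.card (StarNode d m), by linarith, by linarith, (binStar d m).comap e,
    ⟨1, N, le_rfl, ?_, hNη, d, ⟨?_, ?_⟩, ?_⟩, hT, fun M hM => ?_⟩
  · push_cast
    linarith
  · rw [Set.mem_ofPred_eq, hcard]
  · intro d' hd'
    rw [Set.mem_ofPred_eq, natCard_stretchedNode_one, Nat.cast_le] at hd'
    exact card_binNode_le_iff.1 hd'
  · rw [hcard]
    exact ⟨φ.trans (treeStarIso d m).symm⟩
  · have hB := isBGE_iso φ (isBGE_binStar (by linarith : 1 ≤ α) hd1 hN2 hM)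
    have hM' : α * (Fintype.card (Fin (Fintype.card (StarNode d m))) : ℝ) ^ 3 < (M : ℝ) := by
      rwa [Fintype.card_fin]
    refine ⟨hB, isKBSE_two_of_isBGE (by linarith) hM' hT hB, ?_⟩
    have := le_costRatio_of_iso φ hm1 (by linarith : 1 ≤ α) hM' hN2 hdle
      (by rw [Fintype.card_fin]; linarith)
    linarith

/-- If no tree qualifies, the real supremum is 0 by convention; this is why `c` must be nonnegative.
-/
theorem treePoA_le {Eq : ∀ n : ℕ, ℝ → ℕ → SimpleGraph (Fin n) → Prop} {n M : ℕ} {α c : ℝ}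
    (hc : 0 ≤ c) (h : ∀ G : SimpleGraph (Fin n), G.IsTree → Eq n α M G → costRatio α M G ≤ c) :
    treePoA Eq n α M ≤ c := by
  refine Real.sSup_le ?_ hc
  rintro ρ ⟨G, hG, hE, rfl⟩
  exact h G hG hE

theorem costRatio_le_treePoA {Eq : ∀ n : ℕ, ℝ → ℕ → SimpleGraph (Fin n) → Prop} {n M : ℕ} {α : ℝ}
    {G : SimpleGraph (Fin n)} (hG : G.IsTree) (hE : Eq n α M G) :
    costRatio α M G ≤ treePoA Eq n α M := by
  refine le_csSup (Set.Finite.bddAbove ?_) ⟨G, hG, hE, rfl⟩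
  refine (Set.finite_range fun G : SimpleGraph (Fin n) => costRatio α M G).subset ?_
  rintro ρ ⟨G, -, -, rfl⟩
  exact ⟨G, rfl⟩

end Assembly

end BNCG

theorem mainTheorem3 :
    -- stretched tree stars in equilibrium with logarithmic social cost ratio
    (∃ α₀ : ℝ, ∀ α : ℝ, α₀ ≤ α → ∀ η : ℕ, α ≤ (η : ℝ) →
      ∃ n : ℕ, (η : ℝ) ≤ (n : ℝ) ∧ (n : ℝ) ≤ 3 * (η : ℝ) / 2 ∧
        ∃ G : SimpleGraph (Fin n),
          (∃ (k : ℕ) (t : ℝ), BNCG.IsStretchedTreeStar k t η G) ∧ G.IsTree ∧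
          ∀ M : ℕ, α * (n : ℝ) ^ 3 < (M : ℝ) →
            BNCG.IsBGE α M G ∧ BNCG.IsKBSE 2 α M G ∧
            (1 / 4 : ℝ) * Real.logb 2 α - 17 / 8 ≤ BNCG.costRatio α M G) ∧
    -- the upper bound for trees in BSwE
    (∀ α : ℝ, 1 ≤ α → ∀ (n M : ℕ), α * (n : ℝ) ^ 3 < (M : ℝ) →
      ∀ G : SimpleGraph (Fin n), G.IsTree → BNCG.IsBSwE α M G →
        BNCG.costRatio α M G ≤ 2 + 2 * Real.logb 2 α) ∧
    -- on trees, BGE and 2-BSE coincide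
    (∀ α : ℝ, 1 ≤ α → ∀ (n M : ℕ), α * (n : ℝ) ^ 3 < (M : ℝ) →
      ∀ G : SimpleGraph (Fin n), G.IsTree → (BNCG.IsBGE α M G ↔ BNCG.IsKBSE 2 α M G)) ∧
    -- the Price of Anarchy on trees: Θ(log α) for BSwE and BGE, and Ω(log α) for 2-BSE
    (∃ c C α₀ : ℝ, 0 < c ∧ 0 < C ∧ 1 < α₀ ∧ ∀ α : ℝ, α₀ ≤ α →
      (∀ n M : ℕ, α * (n : ℝ) ^ 3 < (M : ℝ) →
        BNCG.treePoA (fun _ => BNCG.IsBSwE) n α M ≤ C * Real.logb 2 α ∧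
        BNCG.treePoA (fun _ => BNCG.IsBGE) n α M ≤ C * Real.logb 2 α) ∧
      (∀ η : ℕ, α ≤ (η : ℝ) →
        ∃ n : ℕ, (η : ℝ) ≤ (n : ℝ) ∧ (n : ℝ) ≤ 3 * (η : ℝ) / 2 ∧
          ∀ M : ℕ, α * (n : ℝ) ^ 3 < (M : ℝ) →
            c * Real.logb 2 α ≤ BNCG.treePoA (fun _ => BNCG.IsBSwE) n α M ∧
            c * Real.logb 2 α ≤ BNCG.treePoA (fun _ => BNCG.IsBGE) n α M ∧
            c * Real.logb 2 α ≤ BNCG.treePoA (fun _ => BNCG.IsKBSE 2) n α M)) := by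
  have upper : ∀ α : ℝ, 1 ≤ α → ∀ (n M : ℕ), α * (n : ℝ) ^ 3 < (M : ℝ) →
      ∀ G : SimpleGraph (Fin n), G.IsTree → BNCG.IsBSwE α M G →
        BNCG.costRatio α M G ≤ 2 + 2 * Real.logb 2 α := fun α hα n M hM G hG hE =>
    BNCG.costRatio_le_of_isBSwE hα (by rwa [Fintype.card_fin]) hG hE
  refine ⟨⟨64, fun α hα η hη => BNCG.exists_stretchedTreeStar hα hη⟩, upper,
    fun α hα n M hM G hG => ⟨BNCG.isKBSE_two_of_isBGE hα (by rwa [Fintype.card_fin]) hG,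
      BNCG.isBGE_of_isKBSE_two⟩, 1 / 8, 4, 2 ^ 17, by norm_num, by norm_num, by norm_num,
    fun α hα => ?_⟩
  -- From 17 on, `17/8` is at most `(log α)/8`, leaving the constant `1/8`; also `2 + 2 log α ≤ 4
  -- log α`.
  have hlog : 17 ≤ Real.logb 2 α := by
    rw [Real.le_logb_iff_rpow_le one_lt_two (by linarith)]
    exact_mod_cast hα
  refine ⟨fun n M hM => ⟨?_, ?_⟩, fun η hη => ?_⟩
  · refine BNCG.treePoA_le (by linarith) fun G hG hE => ?_
    have := upper α (by linarith) n M hM G hG hE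
    linarith
  · refine BNCG.treePoA_le (by linarith) fun G hG hE => ?_
    have := upper α (by linarith) n M hM G hG hE.2
    linarith
  · obtain ⟨n, h1, h2, G, -, hG, h⟩ := BNCG.exists_stretchedTreeStar (by linarith) hη
    refine ⟨n, h1, h2, fun M hM => ?_⟩
    obtain ⟨hB, hK, hρ⟩ := h M hM
    have hρ' : 1 / 8 * Real.logb 2 α ≤ BNCG.costRatio α M G := by linarith
    exact ⟨hρ'.trans (BNCG.costRatio_le_treePoA (Eq := fun _ => BNCG.IsBSwE) hG hB.2),
      hρ'.trans (BNCG.costRatio_le_treePoA (Eq := fun _ => BNCG.IsBGE) hG hB),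
      hρ'.trans (BNCG.costRatio_le_treePoA (Eq := fun _ => BNCG.IsKBSE 2) hG hK)⟩
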